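/- **Setting.** For $k\ge 0$ let $NC_2(2k)$ be the set of non-crossing pair partitions of $\{1,\dots,2k\}$ (with $NC_2(0)=\{\emptyset\}$), and for $p,q\in NC_2(2k)$ let $|p\vee q|$ be the number of blocks of the join of $p$ and $q$ in the lattice of partitions. For $d\in\mathbb C$ let $G_d=[d^{|p\vee q|}]_{p,q\in NC_2(2k)}$ be the Gram matrix and $\mathrm{Wg}_d=G_d^{-1}$ (where $G_d$ is invertible) the Weingarten matrix. Let $\mathrm{TL}_k(d)$ be the Temperley–Lieb algebra with its basis of diagrams $D_p$, $p\in NC_2(2k)$: the points $1,\dots,k$ are placed on the top edge from left to right and $2k,\dots,k+1$ on the bottom edge from left to right, and $D_pD_q=d^cD_r$ is obtained by stacking $D_q$ on top of $D_p$ and removing the $c$ closed loops. Let $D_p^t$ be $D_p$ turned upside down, $\mathrm{Tr}$ the Markov trace ($\mathrm{Tr}(D_p)=d^{\#\text{loops}}$ for the tracial closure of $D_p$), and $\langle x,y\rangle=\mathrm{Tr}(x^ty)$. If this form is non-degenerate, the dual basis $\{\hat D_p\}$ is the one with $\langle D_p,\hat D_q\rangle=\delta_{pq}$. *Non-crossing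 neighbours.* For $p,p'\in NC_2(2k)$ and an interval $\{t,t+1\}\in p$, we say that $p'$ is a non-crossing neighbour of $p$ arising from $\{t,t+1\}$ if $p'\ne p$ and there is another block $\{x,y\}$ of $p$ such that the partition $p''$ obtained from $p$ by joining $\{t,t+1\}$ and $\{x,y\}$ into one block is non-crossing and $p'\le p''$. We write $p\to p'$ if this holds for some interval of $p$. *Weingarten graph.* $\mathcal G$ is the directed graph with vertex set $\bigsqcup_{k\ge0}NC_2(2k)\times NC_2(2k)$ and edges $(p,q)\to(p',q)$ for $p\to p'$, $(p,q)\to(p,q')$ for $q\to q'$, and $(p,q)\to(\tilde p,\tilde q)$ if $\tilde p,\tilde q\in NC_2(2k-2)$ are obtained from $p,q\in NC_2(2k)$ by removing a common interval $\{t,t+1\}$. Paths are directed and may repeat vertices. $L(p,q)$ is the length of a shortest directed path in $\mathcal G$ from $(p,q)$ to $(\emptyset,\emptyset)$. *Weingarten subgraphs.* The orthogonality relation at $(p,q)$ for an interval $\{t,t+1\}$ of $p$ consists of the edges $(p,q)\to(p',q)$ with $p'$ a neighbour of $p$ arising from $\{t,t+1\}$, together with the edge that removes $\{t,t+1\}$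 if this is also a block of $q$; for an interval of $q$ it is defined in the same way with the two coordinates exchanged. A Weingarten subgraph $\mathcal H$ has the vertices of $\mathcal G$ and is obtained by choosing, at each vertex $(p,q)\ne(\emptyset,\emptyset)$, exactly one orthogonality relation, required to contain an edge to some $(p_1,q_1)$ with $L(p_1,q_1)=L(p,q)-1$; the edges of $\mathcal H$ are exactly those of the chosen relations. For a given $\mathcal H$, $m_r(p,q)$ is the number of directed paths of length $L(p,q)+2r$ from $(p,q)$ to $(\emptyset,\emptyset)$ in $\mathcal H$. **Theorem.** Fix a Weingarten subgraph $\mathcal H$, an integer $k\ge0$ and $p,q\in NC_2(2k)$. 1. For every $d\in\mathbb C$ for which $\langle\cdot,\cdot\rangle$ is non-degenerate, $G_d$ is invertible, the dual basis $\{\hat D_p\}$ exists and is unique, and the coefficient of $D_q$ in $\hat D_p$ is $\mathrm{Wg}_d(p,q)$. 2. For every $d\in\mathbb C$ with $|d|>2\cos\big(\frac{\pi}{k+1}\big)$ the form $\langle\cdot,\cdot\rangle$ is non-degenerate, and $$\mathrm{Wg}_d(p,q)=(-1)^{|p\vee q|+k}\sum_{r\ge0}m_r(p,q)\,d^{-L(p,q)-2r},$$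 where the series converges absolutely. 3. All $m_r(p,q)$ are finite and $m_0(p,q)\ge1$. In particular $\mathrm{Wg}_d(p,q)\sim m_0(p,q)(-1)^{k+|p\vee q|}d^{-L(p,q)}$ as $|d|\to\infty$, $d\in\mathbb C$. -/

import Mathlib

/-!
Points of `[2k] = {1, …, 2k}` are numbered from `0`: the point `i` of the usual notation is
`i - 1 : Fin (2 * k)`.
-/

/-! ### Non-crossing pairings -/

/-- A pair partition of `Fin n` is given by the map sending each point to the other point of its
block: an involution without fixed points.  It is non-crossing when there are no two blocks
`{i, f i}`, `{j, f j}` with `i < j < f i < f j`. -/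
def IsNCPairing {n : ℕ} (f : Fin n → Fin n) : Prop :=
  (∀ i, f (f i) = i) ∧ (∀ i, f i ≠ i) ∧ ∀ i j, i < j → j < f i → ¬ f i < f j

instance {n : ℕ} (f : Fin n → Fin n) : Decidable (IsNCPairing f) := by
  unfold IsNCPairing; infer_instance

/-- `NC₂(2k)`: the non-crossing pair partitions of `2k` ordered points. -/
abbrev NC2 (k : ℕ) : Type := {f : Fin (2 * k) → Fin (2 * k) // IsNCPairing f}

/-- A partition of `Fin n` is non-crossing when `a < b < c < d`, `a ~ c` and `b ~ d` imply
`a ~ b`. -/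
def IsNCPartition {n : ℕ} (s : Setoid (Fin n)) : Prop :=
  ∀ a b c d, a < b → b < c → c < d → s a c → s b d → s a b

namespace NC2

/-- The pairing `p` as a partition (equivalence relation) of the `2k` points. -/
def toSetoid {k : ℕ} (p : NC2 k) : Setoid (Fin (2 * k)) where
  r a b := b = a ∨ b = p.1 a
  iseqv :=
    { refl := fun _ => Or.inl rfl
      symm := by
        rintro a b (h | h)
        · exact Or.inl h.symm
        · right; rw [h, p.2.1]
      trans := by
        rintro a b c (h | h) (h' | h')
        · left; rw [h', h]
        · right; rw [h', h]
        · right; rw [h', h]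
        · left; rw [h', h, p.2.1] }

/-- `|p ∨ q|`: the number of blocks of the join of the partitions `p` and `q`. -/
noncomputable def joinCard {k : ℕ} (p q : NC2 k) : ℕ :=
  Nat.card (Quotient (p.toSetoid ⊔ q.toSetoid))

/-- The empty pairing, the only element of `NC₂(0)`. -/
def empty : NC2 0 :=
  ⟨fun i => i, fun i => i.elim0, fun i => i.elim0, fun i => i.elim0⟩

/-! ### Operations on Temperley-Lieb diagrams -/

theorem nc_sym {α : Type*} [LinearOrder α] (f : α → α) (hi : ∀ i, f (f i) = i)
    (hn : ∀ i, f i ≠ i)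
    (hc : ∀ i j, i < j → j < f i → ¬ f i < f j) (u w : α) (h1 : w ≠ u) (h2 : w ≠ f u) :
    (u < w ↔ f u < w) ↔ (u < f w ↔ f u < f w) := by
  have a1 := hi u
  have a2 := hi w
  have h3 : f w ≠ u := by rintro rfl; exact h2 a2.symm
  have h4 : f w ≠ f u := fun h => h1 (by rw [← a2, h, a1])
  have q1 := hc u w
  have q2 := hc (f u) w
  have q3 := hc u (f w)
  have q4 := hc (f u) (f w)
  have r1 := hc w u
  have r2 := hc w (f u)
  have r3 := hc (f w) u
  have r4 := hc (f w) (f u)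
  rw [a1] at *
  rw [a2] at *
  have n1 := hn u
  have n2 := hn w
  generalize f u = u' at *
  generalize f w = w' at *
  clear hc hi hn
  rcases lt_trichotomy u w with h | h | h <;> rcases lt_trichotomy u' w with h' | h' | h' <;>
  rcases lt_trichotomy u w' with k | k | k <;> rcases lt_trichotomy u' w' with k' | k' | k' <;>
  grind

/-- Connecting two neighbouring points `a < b` of a non-crossing pairing creates no crossing. -/
theorem through_nc {α : Type*} [LinearOrder α] (f : α → α) (hi : ∀ i, f (f i) = i)
    (hn : ∀ i, f i ≠ i)
    (hc : ∀ i j, i < j → j < f i → ¬ f i < f j) (a b : α)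
    (hab : ∀ z, z ≠ a → z ≠ b → (z < a ↔ z < b))
    (x y : α) (xa : x ≠ a) (xb : x ≠ b) (ya : y ≠ a) (yb : y ≠ b) (hxy : x < y) 
    (hyx : y < if f x = a then f b else if f x = b then f a else f x) :
    ¬ (if f x = a then f b else if f x = b then f a else f x) <
      if f y = a then f b else if f y = b then f a else f y := by
  have S := nc_sym f hi hn hc
  have hab' : ∀ z, z ≠ a → z ≠ b → (a < z ↔ b < z) := by
    intro z h1 h2; have := hab z h1 h2; grind
  intro h
  have i1 := hi x
  have i2 := hi y
  have s1 := S x y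
  have s2 := S a y
  have s3 := S b y
  have s4 := S y x
  have s5 := S a x
  have s6 := S b x
  have t1 := hab' x xa xb
  have t2 := hab' y ya yb
  have t3 := hab' (f x)
  have t4 := hab' (f y)
  have c := hc x y
  clear hab hab' S hc hi hn
  split_ifs at hyx h <;> grind

/-- The lower middle point `n` of the `2n+2` points `0, …, 2n+1`. -/
def midL (n : ℕ) : Fin (2 * (n + 1)) := ⟨n, by omega⟩

/-- The upper middle point `n+1` of the `2n+2` points `0, …, 2n+1`. -/
def midR (n : ℕ) : Fin (2 * (n + 1)) := ⟨n + 1, by omega⟩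

/-- The order embedding of `2n` points into `2n+2` points that misses `t` and `t+1`. -/
def skip {n : ℕ} (t : ℕ) (i : Fin (2 * n)) : Fin (2 * (n + 1)) :=
  if (i : ℕ) < t then ⟨i, by omega⟩ else ⟨i + 2, by omega⟩

/-- The other end of the strand starting at `x` (not a middle point) once the two middle points
have been connected. -/
def midThrough {n : ℕ} (p : NC2 (n + 1)) (x : Fin (2 * (n + 1))) : Fin (2 * (n + 1)) :=
  if p.1 x = midL n then p.1 (midR n)
  else if p.1 x = midR n then p.1 (midL n)
  else p.1 x

/-- `midThrough` on the points that remain when the middle points are removed, renumbered in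
order. -/
def midJoinFun {n : ℕ} (p : NC2 (n + 1)) (i : Fin (2 * n)) : Fin (2 * n) :=
  if h : (midThrough p (skip n i) : ℕ) < n then ⟨midThrough p (skip n i), by omega⟩
  else ⟨midThrough p (skip n i) - 2, by have := i.2; omega⟩

theorem skip_ne {n : ℕ} (i : Fin (2 * n)) :
    skip n i ≠ midL n ∧ skip n i ≠ midR n := by
  unfold skip midL midR
  constructor <;> split_ifs <;> rw [Ne, Fin.ext_iff] <;> simp only <;> omega

theorem skip_lt {n : ℕ} (t : ℕ) (i j : Fin (2 * n)) : skip t i < skip t j ↔ i < j := by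
  unfold skip
  rw [Fin.lt_def, Fin.lt_def]
  split_ifs <;> simp only <;> omega

theorem skip_inj {n : ℕ} (t : ℕ) {i j : Fin (2 * n)} (h : skip t i = skip t j) : i = j := by
  have h1 := skip_lt t i j
  have h2 := skip_lt t j i
  rw [h] at h1 h2
  simp only [lt_irrefl, false_iff, not_lt] at h1 h2
  exact le_antisymm h2 h1

theorem midThrough_spec {n : ℕ} (p : NC2 (n + 1)) (x : Fin (2 * (n + 1)))
    (h0 : x ≠ midL n) (h1 : x ≠ midR n) :
    midThrough p x ≠ midL n ∧ midThrough p x ≠ midR n ∧ midThrough p x ≠ x ∧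
      midThrough p (midThrough p x) = x := by
  obtain ⟨f, hi, hn, hc⟩ := p
  have hne : midL n ≠ midR n := by simp [midL, midR]
  simp only [midThrough]
  grind

theorem skip_midJoinFun {n : ℕ} (p : NC2 (n + 1)) (i : Fin (2 * n)) :
    skip n (midJoinFun p i) = midThrough p (skip n i) := by
  obtain ⟨h0, h1, -⟩ := midThrough_spec p (skip n i) (skip_ne i).1 (skip_ne i).2
  rw [Ne, Fin.ext_iff] at h0 h1
  rw [Fin.ext_iff]
  simp only [midL, midR] at h0 h1
  unfold midJoinFun
  have hi := i.2
  split_ifs with h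
  · have e : ∀ j : Fin (2 * n), (j : ℕ) < n → (skip n j : ℕ) = j := by
      intro j hj
      rw [skip, if_pos hj]
    exact e _ h
  · have e : ∀ j : Fin (2 * n), ¬ (j : ℕ) < n → (skip n j : ℕ) = j + 2 := by
      intro j hj
      rw [skip, if_neg hj]
    rw [e _ (by simp only; omega)]
    simp only
    omega

/-- Connect the two middle points of `p` by a strand, remove them (together with the loop that
arises if they form a block of `p`), and renumber the other points in order. -/
def midJoin {n : ℕ} (p : NC2 (n + 1)) : NC2 n :=
  ⟨midJoinFun p, by
    have hs := fun i : Fin (2 * n) => midThrough_spec p _ (skip_ne i).1 (skip_ne i).2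
    refine ⟨fun i => skip_inj n ?_, fun i h => ?_, fun i j hij hji h => ?_⟩
    · rw [skip_midJoinFun, skip_midJoinFun, (hs i).2.2.2]
    · exact (hs i).2.2.1 (by rw [← skip_midJoinFun, h])
    · rw [← skip_lt n] at hij hji h
      rw [skip_midJoinFun] at hji h
      rw [skip_midJoinFun] at h
      refine through_nc p.1 p.2.1 p.2.2.1 p.2.2.2 (midL n) (midR n) ?_ _ _ (skip_ne i).1
        (skip_ne i).2 (skip_ne j).1 (skip_ne j).2 hij hji h
      intro z h1 h2
      rw [Ne, Fin.ext_iff] at h1 h2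
      rw [Fin.lt_def, Fin.lt_def]
      simp only [midL, midR] at *
      omega⟩

/-- The number of loops (`0` or `1`) that close up when the two middle points are connected. -/
def midLoop {n : ℕ} (p : NC2 (n + 1)) : ℕ :=
  if p.1 (midL n) = midR n then 1 else 0

/-- The diagram obtained by connecting, one pair after the other from the middle outwards, the
`m` points just before the middle to the `m` points just after the middle. -/
def joinMiddle {n : ℕ} : (m : ℕ) → NC2 (n + m) → NC2 n
  | 0, p => p
  | m + 1, p => joinMiddle m (midJoin (n := n + m) p)

/-- The number of loops that are closed in the course of `joinMiddle`. -/
def joinMiddleLoops {n : ℕ} : (m : ℕ) → NC2 (n + m) → ℕ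
  | 0, _ => 0
  | m + 1, p => midLoop (n := n + m) p + joinMiddleLoops m (midJoin (n := n + m) p)

/-- The points of `q` followed by those of `p`. -/
def juxtFun {k : ℕ} (q p : NC2 k) (i : Fin (2 * (k + k))) : Fin (2 * (k + k)) :=
  if h : (i : ℕ) < 2 * k then ⟨q.1 ⟨i, h⟩, by omega⟩
  else ⟨2 * k + p.1 ⟨i - 2 * k, by omega⟩, by omega⟩

/-- `q` and `p` side by side, the points of `q` coming first. -/
def juxt {k : ℕ} (q p : NC2 k) : NC2 (k + k) :=
  ⟨juxtFun q p, by
    obtain ⟨f, fi, fn, fc⟩ := q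
    obtain ⟨g, gi, gn, gc⟩ := p
    have hl : ∀ (i : Fin (2 * (k + k))) (h : (i : ℕ) < 2 * k),
        (juxtFun ⟨f, fi, fn, fc⟩ ⟨g, gi, gn, gc⟩ i : ℕ) = f ⟨i, h⟩ := by
      intro i h
      rw [juxtFun, dif_pos h]
    have hr : ∀ (i : Fin (2 * (k + k))) (h : ¬ (i : ℕ) < 2 * k),
        (juxtFun ⟨f, fi, fn, fc⟩ ⟨g, gi, gn, gc⟩ i : ℕ) =
          2 * k + g ⟨i - 2 * k, by omega⟩ := by
      intro i h
      rw [juxtFun, dif_neg h]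
    generalize juxtFun ⟨f, fi, fn, fc⟩ ⟨g, gi, gn, gc⟩ = J at hl hr
    refine ⟨fun i => ?_, fun i h => ?_, fun i j h1 h2 h3 => ?_⟩
    · by_cases h : (i : ℕ) < 2 * k
      · have e := hl i h
        have h' : (J i : ℕ) < 2 * k := by rw [e]; exact Fin.is_lt _
        have e' := hl (J i) h'
        rw [Fin.ext_iff, e']
        have : (⟨J i, h'⟩ : Fin (2 * k)) = f ⟨i, h⟩ := Fin.ext e
        rw [this, fi]
      · have e := hr i h
        have h' : ¬ (J i : ℕ) < 2 * k := by omega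
        have e' := hr (J i) h'
        rw [Fin.ext_iff, e']
        have : (⟨J i - 2 * k, by omega⟩ : Fin (2 * k)) = g ⟨i - 2 * k, by omega⟩ :=
          Fin.ext (by simp only; omega)
        rw [this, gi]
        simp only
        omega
    · by_cases h' : (i : ℕ) < 2 * k
      · have e := hl i h'
        exact fn ⟨i, h'⟩ (Fin.ext (by rw [← e, h]))
      · have e := hr i h'
        refine gn ⟨i - 2 * k, by omega⟩ (Fin.ext ?_)
        rw [h] at e
        simp only
        omega
    · rw [Fin.lt_def] at h1 h2 h3
      by_cases hi : (i : ℕ) < 2 * k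
      · have ei := hl i hi
        have hj : (j : ℕ) < 2 * k := by omega
        have ej := hl j hj
        refine fc ⟨i, hi⟩ ⟨j, hj⟩ ?_ ?_ ?_ <;> rw [Fin.lt_def] <;> (try simp only) <;> omega
      · have ei := hr i hi
        have hj : ¬ (j : ℕ) < 2 * k := by omega
        have ej := hr j hj
        refine gc ⟨i - 2 * k, by omega⟩ ⟨j - 2 * k, by omega⟩ ?_ ?_ ?_ <;>
          rw [Fin.lt_def] <;> (try simp only) <;> omega⟩

/-- The diagram `D_r` in `D_p D_q = d ^ c • D_r`: stack `D_q` on top of `D_p` and connect the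
bottom points of `D_q` (from left to right `2k-1, …, k`) to the top points of `D_p` (from left to
right `0, …, k-1`). -/
def stack {k : ℕ} (p q : NC2 k) : NC2 k := joinMiddle k (juxt q p)

/-- The number `c` of internal loops in `D_p D_q = d ^ c • D_r`. -/
def stackLoops {k : ℕ} (p q : NC2 k) : ℕ := joinMiddleLoops k (juxt q p)

/-- The number of loops in the tracial closure of `D_p`, where the `i`-th top point `i` is
connected to the `i`-th bottom point `2k-1-i`, for every `i < k`. -/
def closureLoops : (k : ℕ) → NC2 k → ℕ
  | 0, _ => 0
  | k + 1, p => midLoop p + closureLoops k (midJoin p)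

/-- The diagram `D_p` turned upside down: `i` and `2k-1-i` are interchanged. -/
def flip {k : ℕ} (p : NC2 k) : NC2 k :=
  ⟨fun i => Fin.rev (p.1 (Fin.rev i)), by
    obtain ⟨f, fi, fn, fc⟩ := p
    refine ⟨fun i => ?_, fun i h => ?_, fun i j h1 h2 h3 => ?_⟩
    · simp only [Fin.rev_rev, fi]
    · exact fn (Fin.rev i) (Fin.rev_injective (by rw [Fin.rev_rev]; exact h))
    · simp only [Fin.rev_lt_rev] at h3
      rw [← Fin.rev_lt_rev] at h1 h2
      rw [Fin.rev_rev] at h2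
      exact fc (f (Fin.rev j)) (f (Fin.rev i)) h3 (by rwa [fi]) (by rwa [fi, fi])⟩

end NC2

/-! ### The Temperley-Lieb algebra, the Markov trace and the dual basis -/

/-- The vector space underlying `TL_k(d)`, with the diagrams `D_p`, `p ∈ NC₂(2k)`, as basis. -/
abbrev TL (k : ℕ) : Type := NC2 k →₀ ℂ

namespace TL

/-- The basis of Temperley-Lieb diagrams `D_p`. -/
noncomputable def diagram (k : ℕ) : Module.Basis (NC2 k) ℂ (TL k) := Finsupp.basisSingleOne

/-- The product of `TL_k(d)`: the bilinear map with `D_p D_q = d ^ c • D_r`. -/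
noncomputable def mul (k : ℕ) (d : ℂ) : TL k →ₗ[ℂ] TL k →ₗ[ℂ] TL k :=
  (diagram k).constr ℂ fun p => (diagram k).constr ℂ fun q =>
    d ^ NC2.stackLoops p q • diagram k (NC2.stack p q)

/-- The linear map `x ↦ xᵗ` that turns diagrams upside down. -/
noncomputable def transpose (k : ℕ) : TL k →ₗ[ℂ] TL k :=
  (diagram k).constr ℂ fun p => diagram k (NC2.flip p)

/-- The Markov trace: the linear functional with `Tr D_p = d ^ #loops(D_p)`. -/
noncomputable def markovTrace (k : ℕ) (d : ℂ) : TL k →ₗ[ℂ] ℂ :=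
  (diagram k).constr ℂ fun p => d ^ NC2.closureLoops k p

/-- The bilinear form `⟨x, y⟩ = Tr (xᵗ y)`. -/
noncomputable def form (k : ℕ) (d : ℂ) : LinearMap.BilinForm ℂ (TL k) :=
  LinearMap.mk₂ ℂ (fun x y => markovTrace k d (mul k d (transpose k x) y))
    (by intros; simp only [map_add, LinearMap.add_apply])
    (by intros; simp only [map_smul, LinearMap.smul_apply])
    (by intros; simp only [map_add])
    (by intros; simp only [map_smul])

/-- `E` is the basis dual to the diagram basis: `⟨D_p, E_q⟩ = δ_{pq}`. -/
def IsDualBasis (k : ℕ) (d : ℂ) (E : Module.Basis (NC2 k) ℂ (TL k)) : Prop :=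
  ∀ p q, form k d (diagram k p) (E q) = if p = q then 1 else 0

end TL

/-! ### Gram and Weingarten matrices -/

/-- The Gram matrix `G_d(p, q) = d ^ |p ∨ q|`. -/
noncomputable def gramMatrix (k : ℕ) (d : ℂ) : Matrix (NC2 k) (NC2 k) ℂ :=
  Matrix.of fun p q => d ^ NC2.joinCard p q

/-- The Weingarten matrix, the inverse of the Gram matrix. -/
noncomputable def Wg (k : ℕ) (d : ℂ) : Matrix (NC2 k) (NC2 k) ℂ := (gramMatrix k d)⁻¹

/-! ### Non-crossing neighbours and the Weingarten graph -/

namespace NC2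

/-- `{t, t+1}` is a block of `p`. -/
def IsInterval {k : ℕ} (p : NC2 k) (t : ℕ) : Prop :=
  ∃ a b : Fin (2 * k), (a : ℕ) = t ∧ (b : ℕ) = t + 1 ∧ p.1 a = b

/-- The partition obtained from `p` by joining the block of `a` and the block of `x`. -/
def merge {k : ℕ} (p : NC2 k) (a x : Fin (2 * k)) : Setoid (Fin (2 * k)) where
  r i j := p.toSetoid i j ∨
    ((p.toSetoid a i ∨ p.toSetoid x i) ∧ (p.toSetoid a j ∨ p.toSetoid x j))
  iseqv :=
    { refl := fun i => Or.inl (p.toSetoid.refl i)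
      symm := by
        rintro i j (h | ⟨h, h'⟩)
        · exact Or.inl (p.toSetoid.symm h)
        · exact Or.inr ⟨h', h⟩
      trans := by
        have T := fun {i j l} => @Setoid.trans' _ p.toSetoid i j l
        have S := fun {i j} => @Setoid.symm' _ p.toSetoid i j
        rintro i j l (h | ⟨h1, h2⟩) (h' | ⟨h1', h2'⟩)
        · exact Or.inl (T h h')
        · exact Or.inr ⟨h1'.imp (fun e => T e (S h)) (fun e => T e (S h)), h2'⟩
        · exact Or.inr ⟨h1, h2.imp (fun e => T e h') (fun e => T e h')⟩
        · exact Or.inr ⟨h1, h2'⟩ }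

/-- `p'` is the non-crossing neighbour of `p` arising from the interval `{t, t+1}` of `p` and some
other block `{x, y}` of `p`: the partition `p''` in which these two blocks are joined is
non-crossing, `p' ≤ p''` and `p' ≠ p`. -/
def NeighborAt {k : ℕ} (t : ℕ) (p p' : NC2 k) : Prop :=
  p.IsInterval t ∧ ∃ a x : Fin (2 * k), (a : ℕ) = t ∧ x ≠ a ∧ x ≠ p.1 a ∧
    IsNCPartition (p.merge a x) ∧ p'.toSetoid ≤ p.merge a x ∧ p' ≠ p

/-- `p → p'`: `p'` is a non-crossing neighbour of `p`. -/
def Neighbor {k : ℕ} (p p' : NC2 k) : Prop := ∃ t, NeighborAt t p p'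

/-- `p'` is obtained from `p` by removing the interval `{t, t+1}` of `p` (and renumbering the
other points in order). -/
def Removal {k : ℕ} (t : ℕ) (p : NC2 (k + 1)) (p' : NC2 k) : Prop :=
  p.IsInterval t ∧ ∀ i, p.1 (skip t i) = skip t (p'.1 i)

end NC2

/-- The vertices of the Weingarten graph: `⨆ₖ NC₂(2k) × NC₂(2k)`. -/
abbrev WgVertex : Type := Σ k : ℕ, NC2 k × NC2 k

/-- The vertex `(∅, ∅)`. -/
def emptyVertex : WgVertex := ⟨0, NC2.empty, NC2.empty⟩

/-- The edges of the Weingarten graph. -/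
inductive WgEdge : WgVertex → WgVertex → Prop
  | left {k : ℕ} {p p' q : NC2 k} : p.Neighbor p' → WgEdge ⟨k, p, q⟩ ⟨k, p', q⟩
  | right {k : ℕ} {p q q' : NC2 k} : q.Neighbor q' → WgEdge ⟨k, p, q⟩ ⟨k, p, q'⟩
  | remove {k : ℕ} (t : ℕ) {p q : NC2 (k + 1)} {p' q' : NC2 k} :
      NC2.Removal t p p' → NC2.Removal t q q' → WgEdge ⟨k + 1, p, q⟩ ⟨k, p', q'⟩

/-- The Weingarten graph. -/
def weingartenGraph : Digraph WgVertex := ⟨WgEdge⟩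

/-- The edges `(v, w)` belonging to the orthogonality relation
`d Wg(p, q) + ∑_{p'} Wg(p', q) = δ Wg(p̃, q̃)` at `v = (p, q)` for the interval `{t, t+1}` of `p`:
`p'` runs over the neighbours of `p` arising from `{t, t+1}`, and `(p̃, q̃)` occurs when
`{t, t+1}` is also a block of `q`. -/
inductive LeftRelation (t : ℕ) : WgVertex → WgVertex → Prop
  | neighbor {k : ℕ} {p p' q : NC2 k} : NC2.NeighborAt t p p' →
      LeftRelation t ⟨k, p, q⟩ ⟨k, p', q⟩
  | remove {k : ℕ} {p q : NC2 (k + 1)} {p' q' : NC2 k} :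
      NC2.Removal t p p' → NC2.Removal t q q' → LeftRelation t ⟨k + 1, p, q⟩ ⟨k, p', q'⟩

/-- The edges belonging to the orthogonality relation at `v = (p, q)` for the interval `{t, t+1}`
of the second pairing `q`. -/
inductive RightRelation (t : ℕ) : WgVertex → WgVertex → Prop
  | neighbor {k : ℕ} {p q q' : NC2 k} : NC2.NeighborAt t q q' →
      RightRelation t ⟨k, p, q⟩ ⟨k, p, q'⟩
  | remove {k : ℕ} {p q : NC2 (k + 1)} {p' q' : NC2 k} :
      NC2.Removal t p p' → NC2.Removal t q q' → RightRelation t ⟨k + 1, p, q⟩ ⟨k, p', q'⟩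

/-- The directed paths of length `n` from `v` to `w` in a directed graph, as sequences of `n + 1`
vertices (which may repeat). -/
def dipaths {V : Type*} (G : Digraph V) (n : ℕ) (v w : V) : Set (Fin (n + 1) → V) :=
  {γ | γ 0 = v ∧ γ (Fin.last n) = w ∧ ∀ i : Fin n, G.Adj (γ i.castSucc) (γ i.succ)}

/-- `L(v)`: the length of a shortest directed path from `v` to `(∅, ∅)` in the Weingarten
graph. -/
noncomputable def wgDist (v : WgVertex) : ℕ :=
  sInf {n | (dipaths weingartenGraph n v emptyVertex).Nonempty}

/-- `H` is a Weingarten subgraph: there are no edges starting at `(∅, ∅)`, and at every other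
vertex `v = (p, q)` one orthogonality relation (an interval of `p` or of `q`) has been chosen such
that the edges of `H` starting at `v` are exactly those of this relation, and one of them leads to
a vertex that is closer to `(∅, ∅)`. -/
def IsWeingartenSubgraph (H : Digraph WgVertex) : Prop :=
  (∀ w, ¬ H.Adj emptyVertex w) ∧
  ∀ v, v ≠ emptyVertex →
    (∃ t, (v.2.1.IsInterval t ∧ ∀ w, H.Adj v w ↔ LeftRelation t v w) ∨
      (v.2.2.IsInterval t ∧ ∀ w, H.Adj v w ↔ RightRelation t v w)) ∧
    ∃ w, H.Adj v w ∧ wgDist v = wgDist w + 1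

/-- `m_r(v)`: the number of directed paths of length `L(v) + 2r` from `v` to `(∅, ∅)` in `H`. -/
noncomputable def pathCount (H : Digraph WgVertex) (v : WgVertex) (r : ℕ) : ℕ :=
  (dipaths H (wgDist v + 2 * r) v emptyVertex).ncard

/-! Two operations carry the proof: inserting an interval at `t, t+1` (`ins`) and connecting these
two points (`cap`). They are adjoint for the Gram form: by `joinCard_ins`, the loops formed by `ins
t s` and `r` are those formed by `s` and `cap t r`, plus one if `{t, t+1}` is a block of `r`.
Moreover the neighbours of `p` arising from `{t, t+1}` are exactly the other elements of the fibre
of `cap t` through `p` (`cap_of_neighbor`, `neighbor_of_cap`). Summing `Wg` over such a fibre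
therefore gives the orthogonality relations `Wg_relation`. Closing strands one by one is capping
against the nested pairing `rainbow`, so the same adjointness identifies the trace form with the
Gram matrix (`form_diagram`), and dual bases with its inverse.

Invertibility comes from a path model. Let `S_j` be the rescaled Chebyshev polynomials, `S_j(2 cos
θ) sin θ = sin((j+1)θ)`. If `S_j(d) ≠ 0` for `j ≤ k`, then `sum_pathCoeff` factors the Gram matrix
as a product `A Bᵀ` indexed by closed walks of heights. A walk contributes to a pairing only if it
is constant on the regions cut out by the arcs; the largest such walk is the depth function, and
depth functions biject with pairings. So both factors are triangular with nonzero diagonal. All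
zeros of `S_j` with `j ≤ k` have modulus at most `2 cos(π/(k+1))`.

Comparing the model at `d` and `-d` shows that `(-1)^|p ∨ q|` splits into a factor for `p` and a
factor for `q` (`exists_sign`), so passing to a neighbour flips it. With the sign `(-1)^(|p ∨ q| +
k)` every orthogonality relation becomes `d W(v) = ∑ W(w)` over the edges leaving `v`, with all
coefficients `+1`. Iterating along a Weingarten subgraph expands `W` in powers of `d⁻¹` with path
counts as coefficients, and the remainder is geometrically small once `|d|` exceeds the number of
vertices of level at most `k`. Each edge flips the loop sign, so path lengths have a fixed parity.

Finally the entries of `Wg` are rational in `d` and regular wherever the Gram determinant is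
nonzero. As a function of `d⁻¹` they are holomorphic on the disc of radius `1 / (2 cos(π/(k+1)))`
(the punctured plane extended by `0` when `k = 1`), so the expansion found for large `|d|` converges
there. The case `k = 0` is a single term. -/

/-- Straighten an involution `f` at a new strand joining `a` and `b`. -/
def through {α : Type*} [DecidableEq α] (f : α → α) (a b x : α) : α :=
  if f x = a then f b else if f x = b then f a else f x

theorem through_spec {α : Type*} [DecidableEq α] {f : α → α} (hi : ∀ x, f (f x) = x)
    (hn : ∀ x, f x ≠ x) {a b x : α} (hab : a ≠ b) (ha : x ≠ a) (hb : x ≠ b) :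
    through f a b x ≠ a ∧ through f a b x ≠ b ∧ through f a b x ≠ x ∧
      through f a b (through f a b x) = x := by
  simp only [through]
  grind

/-! ### Inserting an interval and capping two adjacent points. -/

namespace NC2

section points

variable {n : ℕ} (t : Fin (2 * n + 1))

/-- The point `t` of `2n+2` points. -/
def lo : Fin (2 * (n + 1)) := ⟨t, by omega⟩

/-- The point `t+1` of `2n+2` points. -/
def hi : Fin (2 * (n + 1)) := ⟨t + 1, by omega⟩

@[simp] theorem lo_val : (lo t : ℕ) = t := rfl

@[simp] theorem hi_val : (hi t : ℕ) = t + 1 := rfl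

theorem lo_ne_hi : lo t ≠ hi t := by simp [Fin.ext_iff]

theorem skip_val (t : ℕ) (i : Fin (2 * n)) : (skip t i : ℕ) = if (i : ℕ) < t then (i : ℕ) else i + 2 := by
  unfold skip
  split_ifs <;> rfl

theorem skip_ne_lo (i : Fin (2 * n)) : skip t i ≠ lo t := by
  rw [Ne, Fin.ext_iff, skip_val, lo_val]
  split_ifs <;> omega

theorem skip_ne_hi (i : Fin (2 * n)) : skip t i ≠ hi t := by
  rw [Ne, Fin.ext_iff, skip_val, hi_val]
  split_ifs <;> omega

theorem exists_skip {x : Fin (2 * (n + 1))} (h₀ : x ≠ lo t) (h₁ : x ≠ hi t) :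
    ∃ i : Fin (2 * n), skip t i = x := by
  rw [Ne, Fin.ext_iff, lo_val] at h₀
  rw [Ne, Fin.ext_iff, hi_val] at h₁
  have := t.2
  by_cases h : (x : ℕ) < t
  · refine ⟨⟨x, by omega⟩, ?_⟩
    rw [Fin.ext_iff, skip_val, if_pos h]
  · refine ⟨⟨x - 2, by omega⟩, ?_⟩
    rw [Fin.ext_iff, skip_val, if_neg]
    · simp only; omega
    · simp only; omega

theorem forall_points {P : Fin (2 * (n + 1)) → Prop} (h₀ : P (lo t)) (h₁ : P (hi t))
    (h : ∀ i : Fin (2 * n), P (skip t i)) (x) : P x := by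
  by_cases e₀ : x = lo t
  · rwa [e₀]
  by_cases e₁ : x = hi t
  · rwa [e₁]
  obtain ⟨i, rfl⟩ := exists_skip t e₀ e₁
  exact h i

theorem adjacent (z : Fin (2 * (n + 1))) (h₀ : z ≠ lo t) (h₁ : z ≠ hi t) : z < lo t ↔ z < hi t := by
  rw [Ne, Fin.ext_iff, lo_val] at h₀
  rw [Ne, Fin.ext_iff, hi_val] at h₁
  rw [Fin.lt_def, Fin.lt_def, lo_val, hi_val]
  omega

theorem prod_points {M : Type*} [CommMonoid M] (φ : Fin (2 * (n + 1)) → M) :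
    ∏ x, φ x = φ (lo t) * φ (hi t) * ∏ i : Fin (2 * n), φ (skip t i) := by
  classical
  have e : (Finset.univ : Finset (Fin (2 * (n + 1)))) =
      insert (lo t) (insert (hi t) (Finset.univ.image (skip t))) := by
    ext x
    simp only [Finset.mem_univ, Finset.mem_insert, Finset.mem_image, true_and, true_iff]
    exact forall_points t (P := fun x => x = lo t ∨ x = hi t ∨ ∃ i, skip t i = x)
      (Or.inl rfl) (Or.inr (Or.inl rfl)) (fun i => Or.inr (Or.inr ⟨i, rfl⟩)) x
  rw [e, Finset.prod_insert, Finset.prod_insert, Finset.prod_image, mul_assoc]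
  · exact fun i _ j _ h => skip_inj t h
  · simp [skip_ne_hi]
  · simp [skip_ne_lo, lo_ne_hi]

end points

section operations

variable {n : ℕ}

theorem exists_cap (t : Fin (2 * n + 1)) (r : NC2 (n + 1)) :
    ∃ s : NC2 n, ∀ i, skip t (s.1 i) = through r.1 (lo t) (hi t) (skip t i) := by
  have sp := fun i : Fin (2 * n) =>
    through_spec r.2.1 r.2.2.1 (lo_ne_hi t) (skip_ne_lo t i) (skip_ne_hi t i)
  choose f hf using fun i : Fin (2 * n) => exists_skip t (sp i).1 (sp i).2.1
  refine ⟨⟨f, fun i => skip_inj t ?_, fun i h => ?_, fun i j hij hji h => ?_⟩, hf⟩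
  · rw [hf, hf, (sp i).2.2.2]
  · exact (sp i).2.2.1 (by rw [← hf, h])
  · rw [← skip_lt t] at hij hji h
    rw [hf] at hji h
    rw [hf] at h
    exact through_nc r.1 r.2.1 r.2.2.1 r.2.2.2 (lo t) (hi t) (adjacent t) _ _ (skip_ne_lo t i)
      (skip_ne_hi t i) (skip_ne_lo t j) (skip_ne_hi t j) hij hji h

/-- Connect the points `t` and `t+1` of `r`, remove them and renumber the other points. -/
noncomputable def cap (t : Fin (2 * n + 1)) (r : NC2 (n + 1)) : NC2 n := (exists_cap t r).choose

theorem skip_cap (t : Fin (2 * n + 1)) (r : NC2 (n + 1)) (i : Fin (2 * n)) :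
    skip t ((cap t r).1 i) = through r.1 (lo t) (hi t) (skip t i) :=
  (exists_cap t r).choose_spec i

theorem eq_cap {t : Fin (2 * n + 1)} {r : NC2 (n + 1)} {s : NC2 n}
    (h : ∀ i, skip t (s.1 i) = through r.1 (lo t) (hi t) (skip t i)) : s = cap t r :=
  Subtype.ext (funext fun i => skip_inj t ((h i).trans (skip_cap t r i).symm))

theorem exists_ins (t : Fin (2 * n + 1)) (s : NC2 n) :
    ∃ p : NC2 (n + 1), p.1 (lo t) = hi t ∧ p.1 (hi t) = lo t ∧
      ∀ i, p.1 (skip t i) = skip t (s.1 i) := by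
  have : ∀ x : Fin (2 * (n + 1)), ∃ y, (x = lo t → y = hi t) ∧ (x = hi t → y = lo t) ∧
      ∀ i, x = skip t i → y = skip t (s.1 i) := by
    refine forall_points t ⟨hi t, fun _ => rfl, fun h => (lo_ne_hi t h).elim,
      fun i h => (skip_ne_lo t i h.symm).elim⟩ ⟨lo t, fun h => (lo_ne_hi t h.symm).elim,
      fun h => rfl, fun i h => (skip_ne_hi t i h.symm).elim⟩ fun i => ⟨skip t (s.1 i),
      fun h => (skip_ne_lo t i h).elim, fun h => (skip_ne_hi t i h).elim, fun j h => by
        rw [skip_inj t h]⟩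
  choose f f₀ f₁ f₂ using this
  have e₀ := f₀ _ rfl
  have e₁ := f₁ _ rfl
  have e₂ := fun i => f₂ _ i rfl
  refine ⟨⟨f, forall_points t ?_ ?_ ?_, forall_points t ?_ ?_ ?_, ?_⟩, e₀, e₁, e₂⟩
  · rw [e₀, e₁]
  · rw [e₁, e₀]
  · intro i; rw [e₂, e₂, s.2.1]
  · rw [e₀]; exact (lo_ne_hi t).symm
  · rw [e₁]; exact lo_ne_hi t
  · intro i h
    rw [e₂] at h
    exact s.2.2.1 i (skip_inj t h)
  · refine forall_points t ?_ ?_ ?_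
    · intro j h₁ h₂
      rw [e₀] at h₂
      rw [Fin.lt_def] at h₁ h₂
      simp only [lo_val, hi_val] at h₁ h₂
      omega
    · intro j h₁ h₂
      rw [e₁] at h₂
      rw [Fin.lt_def] at h₁ h₂
      simp only [lo_val, hi_val] at h₁ h₂
      omega
    · intro i
      refine forall_points t ?_ ?_ ?_
      · intro h₁ h₂ h₃
        rw [e₀] at h₃
        rw [Fin.lt_def] at h₁ h₂ h₃
        simp only [lo_val, hi_val] at h₁ h₂ h₃
        have := fun h => skip_ne_hi t (s.1 i) (Fin.ext h)
        simp only [hi_val] at this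
        rw [e₂] at h₂ h₃
        omega
      · intro h₁ h₂ h₃
        rw [e₁] at h₃
        rw [Fin.lt_def] at h₁ h₂ h₃
        simp only [lo_val, hi_val] at h₁ h₂ h₃
        omega
      · intro j h₁ h₂ h₃
        rw [e₂] at h₂ h₃
        rw [e₂] at h₃
        rw [skip_lt] at h₁ h₂ h₃
        exact s.2.2.2 i j h₁ h₂ h₃

/-- Insert the interval `{t, t+1}` into `s`. -/
noncomputable def ins (t : Fin (2 * n + 1)) (s : NC2 n) : NC2 (n + 1) := (exists_ins t s).choose

theorem ins_lo (t : Fin (2 * n + 1)) (s : NC2 n) : (ins t s).1 (lo t) = hi t :=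
  (exists_ins t s).choose_spec.1

theorem ins_hi (t : Fin (2 * n + 1)) (s : NC2 n) : (ins t s).1 (hi t) = lo t :=
  (exists_ins t s).choose_spec.2.1

theorem ins_skip (t : Fin (2 * n + 1)) (s : NC2 n) (i) :
    (ins t s).1 (skip t i) = skip t (s.1 i) :=
  (exists_ins t s).choose_spec.2.2 i

theorem cap_ins (t : Fin (2 * n + 1)) (s : NC2 n) : cap t (ins t s) = s :=
  (eq_cap fun i => by
    rw [through, ins_skip, if_neg (skip_ne_lo t _), if_neg (skip_ne_hi t _)]).symm

theorem skip_cap_of_interval {t : Fin (2 * n + 1)} {r : NC2 (n + 1)} (h : r.1 (lo t) = hi t)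
    (i : Fin (2 * n)) : skip t ((cap t r).1 i) = r.1 (skip t i) := by
  have h' : r.1 (hi t) = lo t := by rw [← h, r.2.1]
  rw [skip_cap, through, if_neg, if_neg]
  · intro e
    exact skip_ne_lo t i (by rw [← r.2.1 (skip t i), e, h'])
  · intro e
    exact skip_ne_hi t i (by rw [← r.2.1 (skip t i), e, h])

theorem ins_cap {t : Fin (2 * n + 1)} {r : NC2 (n + 1)} (h : r.1 (lo t) = hi t) :
    ins t (cap t r) = r := by
  refine Subtype.ext (funext (forall_points t ?_ ?_ fun i => ?_))
  · rw [ins_lo, h]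
  · rw [ins_hi, ← h, r.2.1]
  · rw [ins_skip, skip_cap_of_interval h]

theorem isInterval_iff (t : Fin (2 * n + 1)) (p : NC2 (n + 1)) :
    p.IsInterval t ↔ p.1 (lo t) = hi t := by
  constructor
  · rintro ⟨a, b, ha, hb, h⟩
    have e : a = lo t := Fin.ext ha
    have e' : b = hi t := Fin.ext hb
    rw [← e, h, e']
  · exact fun h => ⟨lo t, hi t, rfl, rfl, h⟩

theorem IsInterval.lt {p : NC2 (n + 1)} {t : ℕ} (h : p.IsInterval t) : t < 2 * n + 1 := by
  obtain ⟨a, b, ha, hb, h⟩ := h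
  have := b.2
  omega

theorem removal_iff (t : Fin (2 * n + 1)) (p : NC2 (n + 1)) (p' : NC2 n) :
    Removal t p p' ↔ p.1 (lo t) = hi t ∧ p' = cap t p := by
  rw [Removal, isInterval_iff]
  refine and_congr_right fun h => ⟨fun e => eq_cap fun i => ?_, ?_⟩
  · rw [← skip_cap, skip_cap_of_interval h, e]
  · rintro rfl i
    rw [skip_cap_of_interval h]

/-- Every nonempty non-crossing pairing has an interval. -/
theorem exists_interval (p : NC2 (n + 1)) : ∃ t : Fin (2 * n + 1), p.1 (lo t) = hi t := by
  classical
  -- `m + 1` is the length of an arc opened at `x`. In a shortest arc no room is left: a point `x +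
  -- 1` strictly below it would open a shorter arc.
  have hne : ∃ m : ℕ, ∃ x : Fin (2 * (n + 1)), (p.1 x : ℕ) = x + 1 + m := by
    have h0 : (p.1 ⟨0, by omega⟩ : ℕ) ≠ 0 := fun h => p.2.2.1 ⟨0, by omega⟩ (Fin.ext h)
    exact ⟨(p.1 ⟨0, by omega⟩ : ℕ) - 1, ⟨0, by omega⟩, by simp only; omega⟩
  obtain ⟨x, hx⟩ := Nat.find_spec hne
  have hm := fun m => Nat.find_min (m := m) hne
  generalize Nat.find hne = m at hx hm
  have hp := (p.1 x).2
  rcases Nat.eq_zero_or_pos m with rfl | hpos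
  · exact ⟨⟨x, by omega⟩, Fin.ext hx⟩
  · exfalso
    let y : Fin (2 * (n + 1)) := ⟨x + 1, by omega⟩
    have hy : (y : ℕ) = x + 1 := rfl
    have c1 := p.2.2.2 x y
    have c2 := p.2.2.2 (p.1 y) x
    have n1 := p.2.2.1 y
    have n2 : p.1 y ≠ x := fun h => by
      rw [← h, p.2.1] at hx; omega
    have n3 : p.1 y ≠ p.1 x := fun h => by
      have := congrArg p.1 h
      rw [p.2.1, p.2.1, Fin.ext_iff] at this
      omega
    rw [p.2.1] at c2
    simp only [Fin.lt_def, Ne, Fin.ext_iff] at c1 c2 n1 n2 n3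
    exact hm ((p.1 y : ℕ) - y - 1) (by omega) ⟨y, by omega⟩

/-- Induction on non-crossing pairings by inserting intervals. -/
theorem ins_induction {P : ∀ k, NC2 k → Prop} (h₀ : ∀ p, P 0 p)
    (h : ∀ n (t : Fin (2 * n + 1)) (s : NC2 n), P n s → P (n + 1) (ins t s)) (k : ℕ) (p : NC2 k) :
    P k p := by
  induction k with
  | zero => exact h₀ p
  | succ n ih =>
    obtain ⟨t, ht⟩ := exists_interval p
    rw [← ins_cap ht]
    exact h n t _ (ih _)

end operations

/-! ### Loop counts under insertion, and neighbours as fibres of capping. -/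

section loops

theorem inj {k : ℕ} (r : NC2 k) {x y} (h : r.1 x = r.1 y) : x = y := by
  rw [← r.2.1 x, h, r.2.1]

/-- An arc encloses a point only together with the whole arc of that point. -/
theorem enclosed {k : ℕ} (r : NC2 k) {x w : Fin (2 * k)} (h₁ : x < w) (h₂ : w < r.1 x) :
    x < r.1 w ∧ r.1 w < r.1 x := by
  have c1 := r.2.2.2 x w h₁ h₂
  have c2 := r.2.2.2 (r.1 w) x
  rw [r.2.1] at c2
  have n1 : r.1 w ≠ x := by rintro rfl; rw [r.2.1] at h₂; exact h₂.false
  have n2 : r.1 w ≠ r.1 x := fun e => by rw [r.inj e] at h₁; exact h₁.false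
  exact ⟨lt_of_not_ge fun h => c2 (lt_of_le_of_ne h n1) h₁ h₂,
    lt_of_not_ge fun h => c1 (lt_of_le_of_ne h n2.symm)⟩

variable {k n : ℕ}

theorem joinCard_comm (p q : NC2 k) : p.joinCard q = q.joinCard p := by
  rw [joinCard, joinCard, sup_comm]

theorem join_left (p q : NC2 k) (x) : (p.toSetoid ⊔ q.toSetoid) x (p.1 x) :=
  (le_sup_left : p.toSetoid ≤ p.toSetoid ⊔ q.toSetoid) (Or.inr rfl)

theorem join_right (p q : NC2 k) (x) : (p.toSetoid ⊔ q.toSetoid) x (q.1 x) :=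
  (le_sup_right : q.toSetoid ≤ p.toSetoid ⊔ q.toSetoid) (Or.inr rfl)

theorem join_le {p q : NC2 k} {s : Setoid (Fin (2 * k))} (hp : ∀ x, s x (p.1 x))
    (hq : ∀ x, s x (q.1 x)) : p.toSetoid ⊔ q.toSetoid ≤ s := by
  refine sup_le ?_ ?_
  · rintro x y (rfl | rfl)
    · exact s.refl _
    · exact hp x
  · rintro x y (rfl | rfl)
    · exact s.refl _
    · exact hq x

theorem eq_of_join {α : Type*} {p q : NC2 k} (φ : Fin (2 * k) → α) (hp : ∀ x, φ x = φ (p.1 x))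
    (hq : ∀ x, φ x = φ (q.1 x)) {x y} (h : (p.toSetoid ⊔ q.toSetoid) x y) : φ x = φ y :=
  join_le (s := Setoid.ker φ) hp hq h

/-- Along the loops, the arc of `ins t s` at `t, t+1` acts as the strand that `cap t` uses to
connect the two points, so `skip t` maps join classes to join classes. It misses a class only when
both pairings contain the interval, which is then a loop of its own. Injectivity is shown by
extending the class map to `t` and `t+1` as a function invariant under both pairings. -/
theorem joinCard_ins (t : Fin (2 * n + 1)) (s : NC2 n) (r : NC2 (n + 1)) :
    (ins t s).joinCard r = s.joinCard (cap t r) + if r.1 (lo t) = hi t then 1 else 0 := by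
  classical
  set J := (ins t s).toSetoid ⊔ r.toSetoid with hJ
  set J' := s.toSetoid ⊔ (cap t r).toSetoid with hJ'
  have jl : J (lo t) (hi t) := by simpa [ins_lo] using join_left (ins t s) r (lo t)
  have hle : J' ≤ Setoid.comap (skip t) J := by
    refine join_le (fun i => ?_) (fun i => ?_)
    · rw [Setoid.comap_rel, ← ins_skip]
      exact join_left _ _ _
    · rw [Setoid.comap_rel, skip_cap, through]
      have a := join_right (ins t s) r (skip t i)
      split_ifs with h₁ h₂
      · rw [h₁] at a
        exact J.trans a (J.trans jl (join_right _ _ _))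
      · rw [h₂] at a
        exact J.trans a (J.trans (J.symm jl) (join_right _ _ _))
      · exact a
  let ψ : Quotient J' → Quotient J := Quotient.map (skip t) hle
  -- With a common interval, `none` stands for the extra loop `{t, t+1}`. Otherwise `t` and `t+1`
  -- lie in the class of `u`, the partner of `t` in `r`.
  by_cases h : r.1 (lo t) = hi t
  · rw [if_pos h, joinCard, joinCard, ← Finite.card_option]
    refine (Nat.card_eq_of_bijective
      (fun o : Option (Quotient J') => o.elim (Quotient.mk J (lo t)) ψ) ⟨?_, ?_⟩).symm
    · have : ∀ x : Fin (2 * (n + 1)), ∃ y : Option (Quotient J'), ((x = lo t ∨ x = hi t) → y = none)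
          ∧ ∀ i, x = skip t i → y = some (Quotient.mk J' i) := by
        refine forall_points t ⟨none, by simp, fun i e => (skip_ne_lo t i e.symm).elim⟩
          ⟨none, by simp, fun i e => (skip_ne_hi t i e.symm).elim⟩ fun i => ⟨some (Quotient.mk J' i),
          fun e => (e.elim (skip_ne_lo t i) (skip_ne_hi t i)).elim, fun j e => by rw [skip_inj t e]⟩
      choose φ φ₀ φ₁ using this
      have l₀ := φ₀ _ (Or.inl rfl)
      have l₁ := φ₀ _ (Or.inr rfl)
      have l₂ := fun i => φ₁ _ i rfl
      have inv := @eq_of_join _ _ (ins t s) r φ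
        (forall_points t (by rw [ins_lo, l₀, l₁]) (by rw [ins_hi, l₀, l₁]) fun i => by
          rw [ins_skip, l₂, l₂]
          exact congrArg some (Quotient.sound (join_left _ _ i)))
        (forall_points t (by rw [h, l₀, l₁]) (by rw [← h, r.2.1, h, l₀, l₁]) fun i => by
          rw [← skip_cap_of_interval h, l₂, l₂]
          exact congrArg some (Quotient.sound (join_right _ _ i)))
      rintro (_ | a) (_ | b) e
      · rfl
      · obtain ⟨b, rfl⟩ := Quotient.exists_rep b
        have := inv (Quotient.exact e)
        rw [l₀, l₂] at this
        exact this
      · obtain ⟨a, rfl⟩ := Quotient.exists_rep a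
        have := inv (Quotient.exact e)
        rw [l₀, l₂] at this
        exact this
      · obtain ⟨a, rfl⟩ := Quotient.exists_rep a
        obtain ⟨b, rfl⟩ := Quotient.exists_rep b
        have := inv (Quotient.exact e)
        rw [l₂, l₂] at this
        exact this
    · intro y
      obtain ⟨y, rfl⟩ := Quotient.exists_rep y
      revert y
      refine forall_points t ⟨none, rfl⟩ ⟨none, Quotient.sound jl⟩ fun i => ⟨some (Quotient.mk J' i), rfl⟩
  · rw [if_neg h, add_zero, joinCard, joinCard]
    refine (Nat.card_eq_of_bijective ψ ⟨?_, ?_⟩).symm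
    · obtain ⟨u, hu⟩ := exists_skip t (x := r.1 (lo t)) (r.2.2.1 _) h
      have hu' : r.1 (skip t u) = lo t := by rw [hu, r.2.1]
      obtain ⟨v, hv⟩ := exists_skip t (x := r.1 (hi t))
        (fun e => h (by rw [← e, r.2.1])) (r.2.2.1 _)
      have hv' : r.1 (skip t v) = hi t := by rw [hv, r.2.1]
      have huv : (cap t r).1 u = v := skip_inj t (by rw [skip_cap, through, if_pos hu', hv])
      have huv' : Quotient.mk J' u = Quotient.mk J' v := by
        rw [← huv]; exact Quotient.sound (join_right _ _ u)
      have : ∀ x : Fin (2 * (n + 1)), ∃ y : Quotient J', ((x = lo t ∨ x = hi t) →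
          y = Quotient.mk J' u) ∧ ∀ i, x = skip t i → y = Quotient.mk J' i := by
        refine forall_points t ⟨_, fun _ => rfl, fun i e => (skip_ne_lo t i e.symm).elim⟩
          ⟨_, fun _ => rfl, fun i e => (skip_ne_hi t i e.symm).elim⟩ fun i => ⟨Quotient.mk J' i,
          fun e => (e.elim (skip_ne_lo t i) (skip_ne_hi t i)).elim, fun j e => by rw [skip_inj t e]⟩
      choose φ φ₀ φ₁ using this
      have l₀ := φ₀ _ (Or.inl rfl)
      have l₁ := φ₀ _ (Or.inr rfl)
      have l₂ := fun i => φ₁ _ i rfl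
      have inv := @eq_of_join _ _ (ins t s) r φ
        (forall_points t (by rw [ins_lo, l₀, l₁]) (by rw [ins_hi, l₀, l₁]) fun i => by
          rw [ins_skip, l₂, l₂]
          exact (Quotient.sound (join_left _ _ i)))
        (forall_points t (by rw [← hu, l₀, l₂]) (by rw [← hv, l₁, l₂, huv']) fun i => by
          by_cases e₁ : r.1 (skip t i) = lo t
          · rw [e₁, l₀, l₂]
            rw [← hu'] at e₁
            rw [skip_inj t (r.inj e₁)]
          by_cases e₂ : r.1 (skip t i) = hi t
          · rw [e₂, l₁, l₂]
            rw [← hv'] at e₂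
            rw [skip_inj t (r.inj e₂), huv']
          have : r.1 (skip t i) = skip t ((cap t r).1 i) := by
            rw [skip_cap, through, if_neg e₁, if_neg e₂]
          rw [this, l₂, l₂]
          exact Quotient.sound (join_right _ _ i))
      intro a b e
      obtain ⟨a, rfl⟩ := Quotient.exists_rep a
      obtain ⟨b, rfl⟩ := Quotient.exists_rep b
      have := inv (Quotient.exact e)
      rw [l₂, l₂] at this
      exact this
    · intro y
      obtain ⟨y, rfl⟩ := Quotient.exists_rep y
      obtain ⟨u, hu⟩ := exists_skip t (x := r.1 (lo t)) (r.2.2.1 _) h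
      have ju : J (skip t u) (lo t) := by rw [hu]; exact J.symm (join_right _ _ _)
      revert y
      refine forall_points t ⟨Quotient.mk J' u, Quotient.sound ju⟩
        ⟨Quotient.mk J' u, Quotient.sound (J.trans ju jl)⟩ fun i => ⟨Quotient.mk J' i, rfl⟩

/-- A neighbour re-pairs only the four points of the two merged blocks. Keeping `{t, t+1}` would
give back `p`, so `t` and `t+1` go to the two ends of the other block, and connecting them restores
that block. -/
theorem cap_of_neighbor {t : Fin (2 * n + 1)} {p r : NC2 (n + 1)} (h : NeighborAt t p r) :
    r.1 (lo t) ≠ hi t ∧ cap t r = cap t p := by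
  obtain ⟨ht, a, x, ha, hxa, hxp, -, hle, hne⟩ := h
  rw [isInterval_iff] at ht
  obtain rfl : a = lo t := Fin.ext ha
  rw [ht] at hxp
  have ht' : p.1 (hi t) = lo t := by rw [← ht, p.2.1]
  obtain ⟨i, rfl⟩ := exists_skip t hxa hxp
  set j := (cap t p).1 i with hj
  have hpi : p.1 (skip t i) = skip t j := (skip_cap_of_interval ht i).symm
  have hpj : p.1 (skip t j) = skip t i := by rw [← hpi, p.2.1]
  have mem : ∀ y z, r.1 y = z → z = y ∨ z = p.1 y ∨
      ((y = lo t ∨ y = hi t ∨ y = skip t i ∨ y = skip t j) ∧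
       (z = lo t ∨ z = hi t ∨ z = skip t i ∨ z = skip t j)) := by
    rintro y z rfl
    have := hle (show r.toSetoid y (r.1 y) from Or.inr rfl)
    rcases this with (h | h) | ⟨(h | h) | (h | h), (h' | h') | (h' | h')⟩ <;>
      simp only [ht, hpi] at * <;> grind
  have hij : i ≠ j := (((cap t p).2.2.1) i).symm
  have off : ∀ l, l ≠ i → l ≠ j → r.1 (skip t l) = p.1 (skip t l) := by
    intro l h₁ h₂
    rcases mem _ _ rfl with e | e | ⟨e | e | e | e, -⟩
    · exact (r.2.2.1 _ e).elim
    · exact e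
    · exact (skip_ne_lo t l e).elim
    · exact (skip_ne_hi t l e).elim
    · exact (h₁ (skip_inj t e)).elim
    · exact (h₂ (skip_inj t e)).elim
  have r1 := r.2.1
  have r2 := r.2.2.1
  have nlo := skip_ne_lo t
  have nhi := skip_ne_hi t
  have nlh := lo_ne_hi t
  have sinj : skip t i ≠ skip t j := fun h => hij (skip_inj t h)
  have hnint : r.1 (lo t) ≠ hi t := by
    intro h
    refine hne (Subtype.ext (funext (forall_points t ?_ ?_ fun l => ?_)))
    · rw [h, ht]
    · rw [← h, r1, h, ht']
    · have m1 := mem (skip t i) _ rfl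
      have m2 := mem (skip t j) _ rfl
      by_cases h₁ : l = i
      · subst h₁; grind
      by_cases h₂ : l = j
      · subst h₂; grind
      exact off l h₁ h₂
  refine ⟨hnint, (eq_cap fun l => ?_).symm⟩
  have m0 := mem (lo t) _ rfl
  have m1 := mem (hi t) _ rfl
  have m2 := mem (skip t i) _ rfl
  have m3 := mem (skip t j) _ rfl
  rw [skip_cap_of_interval ht, through]
  by_cases h₁ : l = i
  · subst h₁; grind
  by_cases h₂ : l = j
  · subst h₂; grind
  rw [off l h₁ h₂]
  grind

/-- Together with `cap_of_neighbor` this replaces the lattice definition of neighbours by an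
equation for `cap t`. The second block to merge consists of the partners `u`, `v` of `t`, `t+1` in
`r`, which `cap t` pairs with each other. -/
theorem neighbor_of_cap {t : Fin (2 * n + 1)} {p r : NC2 (n + 1)} (ht : p.1 (lo t) = hi t)
    (hr : r.1 (lo t) ≠ hi t) (h : cap t r = cap t p) : NeighborAt t p r := by
  have ht' : p.1 (hi t) = lo t := by rw [← ht, p.2.1]
  obtain ⟨u, hu⟩ := exists_skip t (r.2.2.1 (lo t)) hr
  have hu' : r.1 (skip t u) = lo t := by rw [hu, r.2.1]
  obtain ⟨v, hv⟩ := exists_skip t (x := r.1 (hi t))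
    (fun e => hr (by rw [← e, r.2.1])) (r.2.2.1 _)
  have hv' : r.1 (skip t v) = hi t := by rw [hv, r.2.1]
  have huv : (cap t r).1 u = v := skip_inj t (by rw [skip_cap, through, if_pos hu', hv])
  have hpu : p.1 (skip t u) = skip t v := by
    rw [← skip_cap_of_interval ht, ← h, huv]
  have hpv : p.1 (skip t v) = skip t u := by rw [← hpu, p.2.1]
  have off : ∀ l, l ≠ u → l ≠ v → r.1 (skip t l) = p.1 (skip t l) := by
    intro l h₁ h₂
    rw [← skip_cap_of_interval ht, ← h, skip_cap, through, if_neg, if_neg]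
    · intro e
      rw [← hv'] at e
      exact h₂ (skip_inj t (r.inj e))
    · intro e
      rw [← hu'] at e
      exact h₁ (skip_inj t (r.inj e))
  have offx : ∀ x, x ≠ lo t → x ≠ hi t → x ≠ skip t u → x ≠ skip t v → r.1 x = p.1 x := by
    refine forall_points t (by simp) (by simp) fun l _ _ h₁ h₂ => off l ?_ ?_
    · rintro rfl; exact h₁ rfl
    · rintro rfl; exact h₂ rfl
  have blk : ∀ x, (p.toSetoid (lo t) x ∨ p.toSetoid (skip t u) x) ↔
      (x = lo t ∨ x = hi t ∨ x = skip t u ∨ x = skip t v) := by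
    intro x
    have e1 : p.toSetoid (lo t) x ↔ (x = lo t ∨ x = p.1 (lo t)) := Iff.rfl
    have e2 : p.toSetoid (skip t u) x ↔ (x = skip t u ∨ x = p.1 (skip t u)) := Iff.rfl
    rw [e1, e2, ht, hpu]
    tauto
  have mrel : ∀ x y, p.merge (lo t) (skip t u) x y ↔ ((y = x ∨ y = p.1 x) ∨
      ((x = lo t ∨ x = hi t ∨ x = skip t u ∨ x = skip t v) ∧
       (y = lo t ∨ y = hi t ∨ y = skip t u ∨ y = skip t v))) := by
    intro x y
    rw [← blk, ← blk]
    exact Iff.rfl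
  refine ⟨(isInterval_iff t p).2 ht, lo t, skip t u, rfl, skip_ne_lo t u, by
    rw [ht]; exact skip_ne_hi t u, ?_, ?_, ?_⟩
  · intro a b c d hab hbc hcd hac hbd
    rw [mrel] at *
    -- An arc of `p` off the four points is also an arc of `r`. It encloses all four or none of
    -- them: `t` and `t+1` are adjacent, and `u`, `v` are tied to them by arcs of `r`.
    have same : ∀ x, ¬ (x = lo t ∨ x = hi t ∨ x = skip t u ∨ x = skip t v) →
        ∀ y, (y = lo t ∨ y = hi t ∨ y = skip t u ∨ y = skip t v) →
        ∀ z, (z = lo t ∨ z = hi t ∨ z = skip t u ∨ z = skip t v) →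
        x < y → y < p.1 x → x < z ∧ z < p.1 x := by
      intro x hx y hy z hz hxy hyx
      simp only [not_or] at hx
      rw [← offx x hx.1 hx.2.1 hx.2.2.1 hx.2.2.2] at hyx ⊢
      have cr := fun w => r.enclosed (x := x) (w := w)
      have c1 := cr (lo t)
      have c2 := cr (hi t)
      have c3 := cr (skip t u)
      have c4 := cr (skip t v)
      rw [← hu] at c1
      rw [← hv] at c2
      rw [hu'] at c3
      rw [hv'] at c4
      have a1 := adjacent t x hx.1 hx.2.1
      have a2 := adjacent t (r.1 x)
        (fun e => hx.2.2.1 (r.inj (by rw [e, hu']))) (fun e => hx.2.2.2 (r.inj (by rw [e, hv'])))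
      have a1' : lo t < x ↔ hi t < x := by
        have := hx.1; have := hx.2.1; grind
      have a2' : lo t < r.1 x ↔ hi t < r.1 x := by
        have e1 := fun e : r.1 x = lo t => hx.2.2.1 (r.inj (y := skip t u) (by rw [e, hu']))
        have e2 := fun e : r.1 x = hi t => hx.2.2.2 (r.inj (y := skip t v) (by rw [e, hv']))
        grind
      have key : ∀ z, (z = lo t ∨ z = hi t ∨ z = skip t u ∨ z = skip t v) →
          ((x < z ∧ z < r.1 x) ↔ (x < lo t ∧ lo t < r.1 x)) := by
        rintro z (rfl | rfl | rfl | rfl)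
        · rfl
        · rw [a1, a2']
        · exact ⟨fun h => c3 h.1 h.2, fun h => c1 h.1 h.2⟩
        · rw [a1, a2']
          exact ⟨fun h => c4 h.1 h.2, fun h => c2 h.1 h.2⟩
      rw [key z hz, ← key y hy]
      exact ⟨hxy, hyx⟩
    rcases hac with (rfl | rfl) | ⟨ha, hc⟩
    · exact ((hab.trans hbc).false).elim
    · rcases hbd with (rfl | rfl) | ⟨hb, hd⟩
      · exact ((hbc.trans hcd).false).elim
      · exact (p.2.2.2 a b hab hbc hcd).elim
      · by_cases ha : a = lo t ∨ a = hi t ∨ a = skip t u ∨ a = skip t v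
        · exact Or.inr ⟨ha, hb⟩
        · exact (lt_asymm hcd (same a ha b hb d hd hab hbc).2).elim
    · rcases hbd with (rfl | rfl) | ⟨hb, hd⟩
      · exact ((hbc.trans hcd).false).elim
      · by_cases hb : b = lo t ∨ b = hi t ∨ b = skip t u ∨ b = skip t v
        · exact Or.inr ⟨ha, hb⟩
        · exact (lt_asymm hab (same b hb c hc a ha hbc hcd).1).elim
      · exact Or.inr ⟨ha, hb⟩
  · rintro x y (rfl | rfl)
    · exact (p.merge _ _).refl _
    · rw [mrel]
      by_cases h₀ : x = lo t
      · subst h₀; right; simp [← hu]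
      by_cases h₁ : x = hi t
      · subst h₁; right; simp [← hv]
      by_cases h₂ : x = skip t u
      · subst h₂; right; simp [hu']
      by_cases h₃ : x = skip t v
      · subst h₃; right; simp [hv']
      rw [offx x h₀ h₁ h₂ h₃]
      simp
  · rintro rfl
    exact hr ht

end loops

end NC2

/-! ### Loops of the closed diagram of `D_pᵗ D_q`. -/

namespace NC2

/-- The nested pairing `i ↔ 2k-1-i`. -/
def rainbow (k : ℕ) : NC2 k :=
  ⟨Fin.rev, Fin.rev_rev, fun i h => by
    rw [Fin.ext_iff, Fin.val_rev] at h
    omega, fun i j h₁ _ h₃ => by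
    rw [Fin.rev_lt_rev] at h₃
    exact lt_asymm h₁ h₃⟩

theorem midJoin_eq_cap {n : ℕ} (p : NC2 (n + 1)) : midJoin p = cap ⟨n, by omega⟩ p :=
  eq_cap fun i => (skip_midJoinFun p i).trans rfl

theorem ins_rainbow (n : ℕ) : rainbow (n + 1) = ins ⟨n, by omega⟩ (rainbow n) := by
  have h : (rainbow (n + 1)).1 (lo ⟨n, by omega⟩) = hi ⟨n, by omega⟩ := by
    simp only [rainbow, lo, hi, Fin.ext_iff, Fin.val_rev]
    omega
  rw [← ins_cap h, ← eq_cap (s := rainbow n)]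
  intro i
  rw [← skip_cap, skip_cap_of_interval h]
  have := i.2
  simp only [rainbow, Fin.ext_iff, Fin.val_rev, skip_val]
  split_ifs <;> omega

theorem joinCard_zero (p q : NC2 0) : p.joinCard q = 0 := by
  have : IsEmpty (Quotient (p.toSetoid ⊔ q.toSetoid)) :=
    ⟨fun x => by obtain ⟨i, -⟩ := Quotient.exists_rep x; exact i.elim0⟩
  rw [joinCard, Nat.card_of_isEmpty]

/-- The innermost arc of the rainbow is an interval in the middle, so this is `joinCard_ins`. It
turns the recursive loop counts of closure and stacking into block counts of a join. -/
theorem joinCard_rainbow_succ {n : ℕ} (p : NC2 (n + 1)) :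
    (rainbow (n + 1)).joinCard p = midLoop p + (rainbow n).joinCard (midJoin p) := by
  rw [ins_rainbow, joinCard_ins, midJoin_eq_cap, add_comm]
  rfl

theorem closureLoops_eq : ∀ (k : ℕ) (p : NC2 k), closureLoops k p = (rainbow k).joinCard p
  | 0, p => (joinCard_zero _ p).symm
  | k + 1, p => by rw [closureLoops, closureLoops_eq k, joinCard_rainbow_succ]

theorem joinMiddleLoops_add {n : ℕ} : ∀ (m : ℕ) (p : NC2 (n + m)),
    joinMiddleLoops m p + (rainbow n).joinCard (joinMiddle m p) = (rainbow (n + m)).joinCard p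
  | 0, p => by rw [joinMiddleLoops, joinMiddle, zero_add]; rfl
  | m + 1, p => by
    rw [joinMiddleLoops, joinMiddle, add_assoc, joinMiddleLoops_add m]
    exact (joinCard_rainbow_succ (n := n + m) p).symm

/-- The rainbow glues the point `4k-1-i` to `i`. This folding undoes the reversal in `flip p` and
lays `p` over `q`. -/
theorem joinCard_rainbow_juxt {k : ℕ} (p q : NC2 k) :
    (rainbow (k + k)).joinCard (juxt q (flip p)) = p.joinCard q := by
  set R := (rainbow (k + k)).toSetoid ⊔ (juxt q (flip p)).toSetoid with hR
  set J := p.toSetoid ⊔ q.toSetoid with hJ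
  let l : Fin (2 * k) → Fin (2 * (k + k)) := fun i => ⟨i, by omega⟩
  -- The folding map; `l` is its section onto the first `2k` points. They induce inverse bijections
  -- of the join classes.
  let φ : Fin (2 * (k + k)) → Fin (2 * k) := fun i =>
    if h : (i : ℕ) < 2 * k then ⟨i, h⟩ else ⟨4 * k - 1 - i, by omega⟩
  have hφl : ∀ i, φ (l i) = i := fun i => by simp [φ, l]
  have hφv : ∀ i : Fin (2 * (k + k)),
      (φ i : ℕ) = if (i : ℕ) < 2 * k then (i : ℕ) else 4 * k - 1 - i := by
    intro i
    simp only [φ]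
    split_ifs <;> rfl
  have rv : ∀ i : Fin (2 * (k + k)), ((rainbow (k + k)).1 i : ℕ) = 4 * k - 1 - i := by
    intro i
    simp only [rainbow, Fin.val_rev]
    omega
  have hφ : ∀ i, φ ((rainbow (k + k)).1 i) = φ i := by
    intro i
    have := i.2
    rw [Fin.ext_iff, hφv, hφv, rv]
    split_ifs <;> omega
  have hlφ : ∀ i, l (φ i) = i ∨ l (φ i) = (rainbow (k + k)).1 i := by
    intro i
    have := i.2
    rw [Fin.ext_iff, Fin.ext_iff, rv]
    simp only [l, hφv]
    split_ifs <;> omega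
  have jl : ∀ i, (juxt q (flip p)).1 (l i) = l (q.1 i) := by
    intro i
    have h : ((l i : Fin _) : ℕ) < 2 * k := i.2
    change juxtFun q (flip p) (l i) = _
    rw [juxtFun, dif_pos h]
  have jr : ∀ i : Fin (2 * (k + k)), ¬ (i : ℕ) < 2 * k → φ ((juxt q (flip p)).1 i) = p.1 (φ i) := by
    intro i h
    have e : Fin.rev (⟨i - 2 * k, by omega⟩ : Fin (2 * k)) = φ i := by
      rw [Fin.ext_iff, hφv, if_neg h, Fin.val_rev]
      simp only
      omega
    have e' : ((juxt q (flip p)).1 i : ℕ) = 2 * k + (2 * k - 1 - p.1 (φ i)) := by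
      change (juxtFun q (flip p) i : ℕ) = _
      rw [juxtFun, dif_neg h, ← e]
      simp only [flip, Fin.val_rev]
      omega
    rw [Fin.ext_iff, hφv, e', if_neg (by omega)]
    have := (p.1 (φ i)).2
    omega
  have hle : R ≤ Setoid.comap φ J := by
    refine join_le (fun i => ?_) (fun i => ?_)
    · rw [Setoid.comap_rel, hφ]
    · rw [Setoid.comap_rel]
      by_cases h : (i : ℕ) < 2 * k
      · have e : l ⟨i, h⟩ = i := rfl
        rw [← e, jl, hφl, hφl]
        exact join_right _ _ _
      · rw [jr i h]
        exact join_left _ _ _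
  have hle' : J ≤ Setoid.comap l R := by
    refine join_le (fun i => ?_) (fun i => ?_)
    · rw [Setoid.comap_rel]
      have h1 := join_left (rainbow (k + k)) (juxt q (flip p)) (l i)
      set x := (rainbow (k + k)).1 (l i) with hx
      have hx' : ¬ (x : ℕ) < 2 * k := by
        have := i.2
        simp only [hx, rainbow, l, Fin.val_rev]
        omega
      have h2 := join_right (rainbow (k + k)) (juxt q (flip p)) x
      have h3 := jr x hx'
      rw [hx, hφ, hφl] at h3
      refine R.trans h1 (R.trans h2 ?_)
      rw [← h3]
      rcases hlφ ((juxt q (flip p)).1 x) with e | e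
      · rw [e]
      · rw [e]
        exact join_left _ _ _
    · rw [Setoid.comap_rel, ← jl]
      exact join_right _ _ _
  refine Nat.card_congr ⟨Quotient.map φ hle, Quotient.map l hle', ?_, ?_⟩
  · intro x
    obtain ⟨x, rfl⟩ := Quotient.exists_rep x
    refine Quotient.sound ?_
    rcases hlφ x with e | e
    · rw [e]
    · rw [e]
      exact R.symm (join_left _ _ _)
  · intro x
    obtain ⟨x, rfl⟩ := Quotient.exists_rep x
    refine Quotient.sound ?_
    rw [hφl]

theorem stackLoops_add_closureLoops {k : ℕ} (p q : NC2 k) :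
    stackLoops (flip p) q + closureLoops k (stack (flip p) q) = p.joinCard q := by
  rw [closureLoops_eq, stackLoops, stack, joinMiddleLoops_add, joinCard_rainbow_juxt]

end NC2

/-! ### The trace form, the Gram matrix and dual bases. -/

theorem Wg_comm (k : ℕ) (d : ℂ) (p q : NC2 k) : Wg k d p q = Wg k d q p := by
  have : (Wg k d).transpose = Wg k d := by
    rw [Wg, Matrix.transpose_nonsing_inv]
    congr 1
    ext p q
    simp [gramMatrix, NC2.joinCard_comm]
  conv_lhs => rw [← this]
  rfl

namespace TL

theorem form_diagram (k : ℕ) (d : ℂ) (p q : NC2 k) :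
    form k d (diagram k p) (diagram k q) = gramMatrix k d p q := by
  simp only [form, LinearMap.mk₂_apply, transpose, mul, markovTrace, Module.Basis.constr_basis,
    map_smul, gramMatrix, Matrix.of_apply, ← NC2.stackLoops_add_closureLoops, pow_add, smul_eq_mul]

theorem toMatrix_form (k : ℕ) (d : ℂ) :
    LinearMap.BilinForm.toMatrix (diagram k) (form k d) = gramMatrix k d := by
  ext p q
  rw [LinearMap.BilinForm.toMatrix_apply, form_diagram]

theorem nondegenerate_iff (k : ℕ) (d : ℂ) :
    (form k d).Nondegenerate ↔ IsUnit (gramMatrix k d) := by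
  rw [Matrix.isUnit_iff_isUnit_det, isUnit_iff_ne_zero,
    LinearMap.BilinForm.nondegenerate_iff_det_ne_zero (diagram k), toMatrix_form]

theorem form_symm (k : ℕ) (d : ℂ) (x y : TL k) : form k d x y = form k d y x := by
  have : form k d = (form k d).flip := by
    refine LinearMap.BilinForm.ext_basis (diagram k) fun p q => ?_
    rw [LinearMap.BilinForm.flip_apply, form_diagram, form_diagram, gramMatrix, Matrix.of_apply,
      Matrix.of_apply, NC2.joinCard_comm]
  conv_lhs => rw [this]
  rfl

/-- Duality says that the coordinate matrix of `E` is a right inverse of the Gram matrix. Its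
columns are the coordinates of the `E p`, so the indices come out transposed and symmetry of `Wg` is
needed. -/
theorem isDualBasis_coeff {k : ℕ} {d : ℂ} {E : Module.Basis (NC2 k) ℂ (TL k)}
    (hE : IsDualBasis k d E) (p q : NC2 k) : (diagram k).repr (E p) q = Wg k d p q := by
  have h : gramMatrix k d * Matrix.of (fun q p => (diagram k).repr (E p) q) = 1 := by
    ext r p
    rw [Matrix.mul_apply, Matrix.one_apply, ← hE r p]
    conv_rhs => rw [← (diagram k).sum_repr (E p)]
    rw [map_sum]
    refine Finset.sum_congr rfl fun q _ => ?_
    rw [map_smul, form_diagram, smul_eq_mul, mul_comm, Matrix.of_apply]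
  rw [Wg_comm, Wg, Matrix.inv_eq_right_inv h]
  rfl

theorem existsUnique_dualBasis {k : ℕ} {d : ℂ} (h : (form k d).Nondegenerate) :
    ∃! E : Module.Basis (NC2 k) ℂ (TL k), IsDualBasis k d E := by
  refine ⟨(form k d).dualBasis h (diagram k), ?_, ?_⟩
  · intro p q
    rw [form_symm, LinearMap.BilinForm.apply_dualBasis_left]
  · intro E hE
    refine Module.Basis.eq_of_apply_eq fun p => (diagram k).repr.injective (Finsupp.ext fun q => ?_)
    rw [isDualBasis_coeff hE, isDualBasis_coeff]
    intro p q
    rw [form_symm, LinearMap.BilinForm.apply_dualBasis_left]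

end TL

/-! ### Chebyshev polynomials and walks of heights. -/

/-- The rescaled Chebyshev polynomials of the second kind:
`S₀ = 1`, `S₁ = d`, `S_{j+2} = d S_{j+1} - S_j`. -/
noncomputable def chebS (d : ℂ) : ℕ → ℂ
  | 0 => 1
  | 1 => d
  | j + 2 => d * chebS d (j + 1) - chebS d j

theorem chebS_neg (d : ℂ) : ∀ j, chebS (-d) j = (-1) ^ j * chebS d j
  | 0 => by simp [chebS]
  | 1 => by simp [chebS]
  | j + 2 => by
    rw [chebS, chebS, chebS_neg d (j + 1), chebS_neg d j]
    ring

/-- The values `chebS d x` form an eigenvector of the half-line graph `ℕ` with eigenvalue `d`; this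
produces the factor `d` of a loop. The `if` encodes `S_{-1} = 0`, since `0 - 1` is `0` in `ℕ`. -/
theorem chebS_add {d : ℂ} (x : ℕ) :
    chebS d (x + 1) + (if 0 < x then chebS d (x - 1) else 0) = d * chebS d x := by
  cases x with
  | zero => simp [chebS]
  | succ x => simp [chebS]

/-- The closed walks of length `2k` on `ℕ` starting at `0`, as sequences of heights. -/
@[ext] structure Walk (k : ℕ) where
  val : ℕ → ℕ
  property : val 0 = 0 ∧ (∀ i < 2 * k, val (i + 1) = val i + 1 ∨ val i = val (i + 1) + 1) ∧
    ∀ i, 2 * k ≤ i → val i = 0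

namespace Walk

variable {k n : ℕ}

theorem le_self (a : Walk k) (i : ℕ) : a.1 i ≤ i := by
  induction i with
  | zero => exact a.2.1.le
  | succ i ih =>
    by_cases h : i < 2 * k
    · have := a.2.2.1 i h; omega
    · rw [a.2.2.2 _ (by omega)]; omega

theorem add_le (a : Walk k) (i : ℕ) (hi : i ≤ 2 * k) : a.1 i + i ≤ 2 * k := by
  obtain ⟨j, rfl⟩ : ∃ j, i = 2 * k - j := ⟨2 * k - i, by omega⟩
  clear hi
  induction j with
  | zero => rw [a.2.2.2 _ (by omega)]; omega
  | succ j ih =>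
    by_cases h : j < 2 * k
    · have := a.2.2.1 (2 * k - (j + 1)) (by omega)
      rw [show 2 * k - (j + 1) + 1 = 2 * k - j by omega] at this
      omega
    · rw [show 2 * k - (j + 1) = 2 * k - j by omega]; exact ih

theorem le_half (a : Walk k) (i : ℕ) : a.1 i ≤ k := by
  by_cases h : i ≤ 2 * k
  · have := a.le_self i
    have := a.add_le i h
    omega
  · rw [a.2.2.2 _ (by omega)]; omega

/-- Each step changes the height by one, so height and time have equal parity. Hence signs depending
on heights do not depend on the walk. -/
theorem neg_one_pow (a : Walk k) {i : ℕ} (hi : i ≤ 2 * k) : (-1 : ℂ) ^ a.1 i = (-1) ^ i := by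
  induction i with
  | zero => rw [a.2.1]
  | succ i ih =>
    have ih := ih (by omega)
    rcases a.2.2.1 i (by omega) with h | h
    · rw [h, pow_succ, pow_succ, ih]
    · rw [pow_succ, ← ih, h, pow_succ]; ring

instance : Finite (Walk k) := by
  refine Finite.of_injective (β := Fin (2 * k + 1) → Fin (2 * k + 1))
    (fun a i => ⟨a.1 i, by have := a.le_self i; omega⟩) fun a b h => Walk.ext (funext fun i => ?_)
  by_cases hi : i < 2 * k + 1
  · exact congrArg Fin.val (congrFun h ⟨i, hi⟩)
  · rw [a.2.2.2 _ (by omega), b.2.2.2 _ (by omega)]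

noncomputable instance : Fintype (Walk k) := Fintype.ofFinite _

instance : PartialOrder (Walk k) := PartialOrder.lift Walk.val fun _ _ => Walk.ext

end Walk

/-- Insert an excursion to height `y` at time `t`. -/
def putHeight (t y : ℕ) (a : ℕ → ℕ) (i : ℕ) : ℕ :=
  if i ≤ t then a i else if i = t + 1 then y else a (i - 2)

/-- Remove the times `t+1` and `t+2`. -/
def delHeight (t : ℕ) (a : ℕ → ℕ) (i : ℕ) : ℕ := if i ≤ t then a i else a (i + 2)

open NC2

section heights

variable {n : ℕ} (t : Fin (2 * n + 1)) (y : ℕ) (a : ℕ → ℕ)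

@[simp] theorem put_lo : putHeight t y a (lo t) = a t := by simp [putHeight]

@[simp] theorem put_lo_succ : putHeight t y a (lo t + 1) = y := by simp [putHeight]

@[simp] theorem put_hi : putHeight t y a (hi t) = y := by simp [putHeight]

@[simp] theorem put_hi_succ : putHeight t y a (hi t + 1) = a t := by simp [putHeight]

@[simp] theorem put_skip (i : Fin (2 * n)) : putHeight t y a (skip t i) = a i := by
  rw [skip_val, putHeight]
  split_ifs <;> first | rfl | omega

@[simp] theorem put_skip_succ (i : Fin (2 * n)) : putHeight t y a (skip t i + 1) = a (i + 1) := by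
  rw [skip_val, putHeight]
  split_ifs <;> first | rfl | omega

theorem put_del (h : a t = a (t + 2)) : putHeight t (a (t + 1)) (delHeight t a) = a := by
  funext i
  unfold putHeight delHeight
  split_ifs with h₁ h₂ h₃
  · rfl
  · rw [h₂]
  · rw [show i = t + 2 by omega, ← h]; rfl
  · rw [show i - 2 + 2 = i by omega]

theorem del_put : delHeight t (putHeight t y a) = a := by
  funext i
  simp only [putHeight, delHeight]
  split_ifs <;> first | rfl | omega

theorem del_le {a b : ℕ → ℕ} (ha : a t = a (t + 2)) (hb : b t = b (t + 2))
    (h₁ : b (t + 1) ≤ a (t + 1)) (h : ∀ i, delHeight t b i ≤ delHeight t a i) (i : ℕ) :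
    b i ≤ a i := by
  rw [← put_del t a ha, ← put_del t b hb]
  unfold putHeight
  split_ifs
  · exact h _
  · exact h₁
  · exact h _

end heights

namespace Walk

variable {k n : ℕ}

/-- Insert an excursion into a walk. -/
def put (t : Fin (2 * n + 1)) (a : Walk n) (y : ℕ) (h : y = a.1 t + 1 ∨ a.1 t = y + 1) :
    Walk (n + 1) :=
  ⟨putHeight t y a.1, by
    have a₀ := a.2.1
    have a₁ := a.2.2.1
    have a₂ := a.2.2.2
    have ht := t.2
    generalize a.1 = a at *
    refine ⟨?_, fun i hi => ?_, fun i hi => ?_⟩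
    · simp [putHeight, a₀]
    · simp only [putHeight]
      rcases lt_trichotomy i t with h' | rfl | h'
      · rw [if_pos (by omega), if_pos (by omega)]
        exact a₁ i (by omega)
      · simpa using h
      · rw [if_neg (by omega), if_neg (by omega), if_neg (by omega)]
        rcases Nat.lt_or_ge (t + 1) i with h'' | h''
        · rw [if_neg (by omega)]
          have := a₁ (i - 2) (by omega)
          rwa [show i - 2 + 1 = i + 1 - 2 by omega] at this
        · rw [if_pos (by omega), show i + 1 - 2 = t by omega]
          omega
    · simp only [putHeight]
      rw [if_neg (by omega), if_neg (by omega)]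
      exact a₂ _ (by omega)⟩

/-- Remove an excursion from a walk. -/
def del (t : Fin (2 * n + 1)) (a : Walk (n + 1)) (h : a.1 t = a.1 (t + 2)) : Walk n :=
  ⟨delHeight t a.1, by
    have a₀ := a.2.1
    have a₁ := a.2.2.1
    have a₂ := a.2.2.2
    have ht := t.2
    generalize a.1 = a at *
    refine ⟨?_, fun i hi => ?_, fun i hi => ?_⟩
    · simp [delHeight, a₀]
    · simp only [delHeight]
      rcases lt_trichotomy i t with h' | rfl | h'
      · rw [if_pos (by omega), if_pos (by omega)]
        exact a₁ i (by omega)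
      · rw [if_pos le_rfl, if_neg (by omega), h]
        exact a₁ _ (by omega)
      · rw [if_neg (by omega), if_neg (by omega)]
        exact a₁ (i + 2) (by omega)
    · simp only [delHeight]
      split_ifs
      · rw [show i = t by omega, h]
        exact a₂ _ (by omega)
      · exact a₂ _ (by omega)⟩

/-- A walk with equal heights at times `t` and `t+2` is, in a unique way, a shorter walk with an
excursion up or down inserted at time `t`; the downward one requires positive height. -/
theorem sum_put {M : Type*} [AddCommMonoid M] (t : Fin (2 * n + 1)) (F : Walk (n + 1) → M)
    (hF : ∀ a, a.1 t ≠ a.1 (t + 2) → F a = 0) :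
    ∑ a, F a = ∑ b : Walk n, (F (b.put t (b.1 t + 1) (Or.inl rfl)) +
      if h : 0 < b.1 t then F (b.put t (b.1 t - 1) (Or.inr (by omega))) else 0) := by
  classical
  have pt : ∀ (b : Walk n) y h, (b.put t y h).1 t = b.1 t := fun b y h => put_lo t y b.1
  have pt1 : ∀ (b : Walk n) y h, (b.put t y h).1 (t + 1) = y := fun b y h => put_hi t y b.1
  have pt2 : ∀ (b : Walk n) y h, (b.put t y h).1 (t + 2) = b.1 t :=
    fun b y h => put_hi_succ t y b.1
  have dt : ∀ a h, (del t a h).1 t = a.1 t := fun a h => by simp [del, delHeight]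
  rw [Finset.sum_add_distrib,
    ← Finset.sum_filter_add_sum_filter_not Finset.univ (fun a : Walk (n + 1) => a.1 t = a.1 (t + 2)),
    Finset.sum_eq_zero (s := Finset.univ.filter fun a : Walk (n + 1) => ¬ a.1 t = a.1 (t + 2))
      (fun a ha => hF a (Finset.mem_filter.1 ha).2), add_zero,
    ← Finset.sum_filter_add_sum_filter_not _ (fun a : Walk (n + 1) => a.1 (t + 1) = a.1 t + 1),
    Finset.filter_filter, Finset.filter_filter]
  congr 1
  · refine Finset.sum_bij' (fun a ha => del t a (Finset.mem_filter.1 ha).2.1)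
      (fun b _ => b.put t (b.1 t + 1) (Or.inl rfl)) ?_ ?_ ?_ ?_ ?_
    · simp
    · intro b _
      simp [pt, pt1, pt2]
    · intro a ha
      refine Walk.ext ?_
      have h := (Finset.mem_filter.1 ha).2
      change putHeight t ((del t a h.1).1 t + 1) (delHeight t a.1) = a.1
      rw [dt, ← h.2, put_del t _ h.1]
    · intro b _
      exact Walk.ext (del_put t _ _)
    · intro a ha
      congr 1
      refine Walk.ext ?_
      have h := (Finset.mem_filter.1 ha).2
      change a.1 = putHeight t ((del t a h.1).1 t + 1) (delHeight t a.1)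
      rw [dt, ← h.2, put_del t _ h.1]
  · rw [← Finset.sum_filter_add_sum_filter_not Finset.univ (fun b : Walk n => 0 < b.1 t),
      Finset.sum_eq_zero (s := Finset.univ.filter fun b : Walk n => ¬ 0 < b.1 t)
        (fun b hb => dif_neg (Finset.mem_filter.1 hb).2), add_zero]
    have st : ∀ a : Walk (n + 1), (a.1 t = a.1 (t + 2) ∧ ¬ a.1 (t + 1) = a.1 t + 1) →
        a.1 t = a.1 (t + 1) + 1 := fun a h => (a.2.2.1 t (by omega)).resolve_left h.2
    refine Finset.sum_bij' (fun a ha => del t a (Finset.mem_filter.1 ha).2.1)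
      (fun b hb => b.put t (b.1 t - 1) (Or.inr (by have := (Finset.mem_filter.1 hb).2; omega)))
      ?_ ?_ ?_ ?_ ?_
    · intro a ha
      have h := st a (Finset.mem_filter.1 ha).2
      rw [Finset.mem_filter, dt]
      exact ⟨Finset.mem_univ _, by omega⟩
    · intro b hb
      have h := (Finset.mem_filter.1 hb).2
      rw [Finset.mem_filter, pt, pt1, pt2]
      exact ⟨Finset.mem_univ _, rfl, by omega⟩
    · intro a ha
      refine Walk.ext ?_
      have h := (Finset.mem_filter.1 ha).2
      have h' := st a h
      change putHeight t ((del t a h.1).1 t - 1) (delHeight t a.1) = a.1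
      rw [dt, h', Nat.add_sub_cancel, put_del t _ h.1]
    · intro b _
      exact Walk.ext (del_put t _ _)
    · intro a ha
      have h := (Finset.mem_filter.1 ha).2
      have h' := st a h
      rw [dif_pos (by rw [dt]; omega)]
      congr 1
      refine Walk.ext ?_
      change a.1 = putHeight t ((del t a h.1).1 t - 1) (delHeight t a.1)
      rw [dt, h', Nat.add_sub_cancel, put_del t _ h.1]

end Walk

/-! ### Compatible heights and the factorization of the Gram matrix. -/

/-- The heights `a` are constant on the regions cut out by the arcs of `p`. -/
def Compat {k : ℕ} (p : NC2 k) (a : ℕ → ℕ) : Prop := ∀ i, a (p.1 i) = a (i + 1)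

/-- The product over the arcs of `p` of the weights of the crossed pair of heights. -/
noncomputable def arcWeight (F : ℕ → ℕ → ℂ) {k : ℕ} (p : NC2 k) (a : ℕ → ℕ) : ℂ :=
  ∏ i : Fin (2 * k), if i < p.1 i then F (a i) (a (i + 1)) else 1

open Classical in
/-- The coefficients of `p` in the path basis. -/
noncomputable def pathCoeff (F : ℕ → ℕ → ℂ) {k : ℕ} (p : NC2 k) (a : ℕ → ℕ) : ℂ :=
  if Compat p a then arcWeight F p a else 0

section compat

variable {k n : ℕ}

theorem compat_put_iff {t : Fin (2 * n + 1)} {r : NC2 (n + 1)} (h : r.1 (lo t) = hi t) (y : ℕ)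
    (b : ℕ → ℕ) : Compat r (putHeight t y b) ↔ Compat (cap t r) b := by
  have h' : r.1 (hi t) = lo t := by rw [← h, r.2.1]
  constructor
  · intro H i
    have := H (skip t i)
    rwa [← skip_cap_of_interval h, put_skip, put_skip_succ] at this
  · intro H
    refine forall_points t ?_ ?_ fun i => ?_
    · rw [h, put_hi, put_lo_succ]
    · rw [h', put_lo, put_hi_succ]
    · rw [← skip_cap_of_interval h, put_skip, put_skip_succ]
      exact H i

theorem Compat.eq_of_interval {t : Fin (2 * n + 1)} {r : NC2 (n + 1)} (h : r.1 (lo t) = hi t)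
    {a : ℕ → ℕ} (H : Compat r a) : a t = a (t + 2) := by
  have := H (hi t)
  rwa [← h, r.2.1, h] at this

theorem arcWeight_put (F : ℕ → ℕ → ℂ) {t : Fin (2 * n + 1)} {r : NC2 (n + 1)}
    (h : r.1 (lo t) = hi t) (y : ℕ) (b : ℕ → ℕ) :
    arcWeight F r (putHeight t y b) = F (b t) y * arcWeight F (cap t r) b := by
  have h' : r.1 (hi t) = lo t := by rw [← h, r.2.1]
  rw [arcWeight, prod_points t, h, h', put_lo, put_lo_succ, if_pos, if_neg, mul_one, arcWeight]
  · congr 1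
    refine Finset.prod_congr rfl fun i _ => ?_
    rw [← skip_cap_of_interval h, put_skip, put_skip_succ]
    simp only [skip_lt]
  · simp [Fin.lt_def]
  · simp [Fin.lt_def]

theorem pathCoeff_put (F : ℕ → ℕ → ℂ) {t : Fin (2 * n + 1)} {r : NC2 (n + 1)}
    (h : r.1 (lo t) = hi t) (y : ℕ) (b : ℕ → ℕ) :
    pathCoeff F r (putHeight t y b) = F (b t) y * pathCoeff F (cap t r) b := by
  rw [pathCoeff, pathCoeff, compat_put_iff h, arcWeight_put F h, mul_ite, mul_zero]

/-- The points in `[m, n)` are paired among themselves, so the gaps `m` and `n` lie in the same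
region: one jumps from `m` over its arc and continues behind it. -/
theorem Compat.balanced {p : NC2 k} {a : ℕ → ℕ} (H : Compat p a) {m n : ℕ} (hmn : m ≤ n)
    (hn : n ≤ 2 * k)
    (h : ∀ i : Fin (2 * k), m ≤ i → (i : ℕ) < n → m ≤ p.1 i ∧ (p.1 i : ℕ) < n) : a m = a n := by
  induction hl : n - m using Nat.strong_induction_on generalizing m with
  | _ l ih =>
  rcases hmn.eq_or_lt with rfl | hlt
  · rfl
  · let i : Fin (2 * k) := ⟨m, by omega⟩
    have hi := h i le_rfl hlt
    have hne : (p.1 i : ℕ) ≠ m := fun e => p.2.2.1 i (Fin.ext e)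
    have e := H (p.1 i)
    rw [p.2.1] at e
    refine e.trans (ih _ ?_ (by omega) (fun l h₁ h₂ => ?_) rfl)
    · omega
    · have hl := h l (by omega) h₂
      refine ⟨?_, hl.2⟩
      have n1 : (p.1 l : ℕ) ≠ m := fun e => by
        have : p.1 l = i := Fin.ext e
        rw [← this, p.2.1] at h₁
        omega
      have n2 : (p.1 l : ℕ) ≠ p.1 i := fun e => by
        have := p.inj (Fin.ext e)
        rw [this] at h₁
        have : (i : ℕ) = m := rfl
        omega
      have c := p.2.2.2 i (p.1 l)
      rw [p.2.1] at c
      simp only [Fin.lt_def] at c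
      have : (i : ℕ) = m := rfl
      omega

/-- The positions of the points connected to `t` and `t+1`. -/
structure Turn (t : Fin (2 * n + 1)) (r : NC2 (n + 1)) (u v : Fin (2 * n)) : Prop where
  lo : r.1 (lo t) = skip t u
  hi : r.1 (hi t) = skip t v

theorem exists_turn {t : Fin (2 * n + 1)} {r : NC2 (n + 1)} (h : r.1 (lo t) ≠ hi t) :
    ∃ u v, Turn t r u v := by
  obtain ⟨u, hu⟩ := exists_skip t (r.2.2.1 (lo t)) h
  obtain ⟨v, hv⟩ := exists_skip t (x := r.1 (hi t))
    (fun e => h (by rw [← e, r.2.1])) (r.2.2.1 _)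
  exact ⟨u, v, hu.symm, hv.symm⟩

namespace Turn

variable {t : Fin (2 * n + 1)} {r : NC2 (n + 1)} {u v : Fin (2 * n)} (T : Turn t r u v)
include T

theorem skip_u : r.1 (skip t u) = NC2.lo t := by rw [← T.lo, r.2.1]

theorem skip_v : r.1 (skip t v) = NC2.hi t := by rw [← T.hi, r.2.1]

theorem cap_u : (cap t r).1 u = v := skip_inj t (by rw [skip_cap, through, if_pos T.skip_u, T.hi])

theorem cap_v : (cap t r).1 v = u := by rw [← T.cap_u, (cap t r).2.1]

theorem ne : u ≠ v := fun h => (cap t r).2.2.1 u (by rw [T.cap_u, h])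

theorem skip_cap_of_ne {i : Fin (2 * n)} (h₁ : i ≠ u) (h₂ : i ≠ v) :
    skip t ((cap t r).1 i) = r.1 (skip t i) := by
  rw [skip_cap, through, if_neg, if_neg]
  · intro e
    rw [← T.skip_v] at e
    exact h₂ (skip_inj t (r.inj e))
  · intro e
    rw [← T.skip_u] at e
    exact h₁ (skip_inj t (r.inj e))

/-- The planar positions of the two strands at `t` and `t+1`: pointing away from each other, or
nested on the left, or nested on the right. -/
theorem cases : ((u : ℕ) < t ∧ (t : ℕ) ≤ v) ∨ (v < u ∧ (u : ℕ) < t) ∨ ((t : ℕ) ≤ v ∧ v < u) := by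
  have c1 := r.2.2.2 (skip t v) (NC2.lo t)
  have c2 := r.2.2.2 (skip t u) (skip t v)
  have c3 := r.2.2.2 (NC2.lo t) (NC2.hi t)
  have hne := T.ne
  rw [T.skip_v, T.lo] at c1
  rw [T.skip_u, T.skip_v] at c2
  rw [T.lo, T.hi] at c3
  simp only [Fin.lt_def, lo_val, hi_val, skip_val, Ne, Fin.ext_iff] at c1 c2 c3 hne ⊢
  split_ifs at c1 c2 c3 <;> omega

/-- The gap `t` lies in the region on one side of the strand that results from joining `u` and `v`.
-/
theorem height {b : ℕ → ℕ} (H : Compat (cap t r) b) : b v = b t ∧ b (u + 1) = b t := by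
  have e := H u
  rw [T.cap_u] at e
  -- If `u` is left of `t`, the points between `u` and `t` are closed under `cap t r`; otherwise
  -- those between `t` and `v` are. Compatibility along the arc `u, v` gives the other equality.
  have key : b (u + 1) = b t ∨ b t = b v := by
    have ht := t.2
    by_cases hu : (u : ℕ) < t
    · left
      refine H.balanced hu (by omega) fun i h₁ h₂ => ?_
      have enc := r.enclosed (x := skip t u) (w := skip t i) (by rw [skip_lt, Fin.lt_def]; omega)
        (by rw [T.skip_u, Fin.lt_def, lo_val, skip_val, if_pos h₂]; exact h₂)
      have hv : i ≠ v := by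
        rintro rfl
        rw [T.skip_v, T.skip_u] at enc
        have := enc.2
        simp [Fin.lt_def] at this
      rw [← T.skip_cap_of_ne (by rintro rfl; omega) hv, skip_lt, T.skip_u, Fin.lt_def,
        Fin.lt_def, skip_val, lo_val] at enc
      split_ifs at enc <;> omega
    · right
      have hv : (t : ℕ) ≤ v := by
        have := T.cases; omega
      refine H.balanced hv (by omega) fun i h₁ h₂ => ?_
      have enc := r.enclosed (x := NC2.hi t) (w := skip t i)
        (by rw [Fin.lt_def, hi_val, skip_val, if_neg (by omega)]; omega)
        (by rw [T.hi, skip_lt, Fin.lt_def]; exact h₂)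
      have hiu : i ≠ u := by
        rintro rfl
        rw [T.skip_u, T.hi] at enc
        have := enc.1
        simp [Fin.lt_def] at this
      rw [← T.skip_cap_of_ne hiu (by rintro rfl; omega), T.hi, skip_lt, Fin.lt_def,
        Fin.lt_def, skip_val, hi_val] at enc
      split_ifs at enc <;> omega
  omega

theorem compat_put_iff (y : ℕ) (b : ℕ → ℕ) :
    Compat r (putHeight t y b) ↔ Compat (cap t r) b ∧ y = b u := by
  constructor
  · intro H
    have h0 := H (NC2.lo t)
    have h1 := H (NC2.hi t)
    have h2 := H (skip t u)
    have h3 := H (skip t v)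
    rw [T.lo, put_skip, put_lo_succ] at h0
    rw [T.hi, put_skip, put_hi_succ] at h1
    rw [T.skip_u, put_lo, put_skip_succ] at h2
    rw [T.skip_v, put_hi, put_skip_succ] at h3
    refine ⟨fun i => ?_, h0.symm⟩
    by_cases e₁ : i = u
    · rw [e₁, T.cap_u, h1, h2]
    by_cases e₂ : i = v
    · rw [e₂, T.cap_v, h0, h3]
    have := H (skip t i)
    rwa [← T.skip_cap_of_ne e₁ e₂, put_skip, put_skip_succ] at this
  · rintro ⟨H, rfl⟩
    have hh := T.height H
    have hv := H v
    rw [T.cap_v] at hv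
    refine forall_points t ?_ ?_ fun i => ?_
    · rw [T.lo, put_skip, put_lo_succ]
    · rw [T.hi, put_skip, put_hi_succ, hh.1]
    · by_cases e₁ : i = u
      · rw [e₁, T.skip_u, put_lo, put_skip_succ, hh.2]
      by_cases e₂ : i = v
      · rw [e₂, T.skip_v, put_hi, put_skip_succ, hv]
      rw [← T.skip_cap_of_ne e₁ e₂, put_skip, put_skip_succ]
      exact H i

/-- Straightening replaces two arcs by one. In each of the three positions, exactly one of the two
old arcs has outer height `b u` and disappears from the product, while the other has the outer
height of the new arc; the factor `S (b u)` compensates. -/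
theorem arcWeight_put {S : ℕ → ℂ} {b : ℕ → ℕ} (H : Compat (cap t r) b) (hS : S (b u) ≠ 0) :
    S (b u) * arcWeight (fun x _ => (S x)⁻¹) r (putHeight t (b u) b) =
      arcWeight (fun x _ => (S x)⁻¹) (cap t r) b := by
  have hh := (T.height H).1
  rw [arcWeight, prod_points t, T.lo, T.hi, put_lo, put_hi, arcWeight,
    ← Finset.mul_prod_erase _ _ (Finset.mem_univ u),
    ← Finset.mul_prod_erase _ _ (Finset.mem_erase.2 ⟨T.ne.symm, Finset.mem_univ v⟩),
    ← Finset.mul_prod_erase _ (fun i => if i < (cap t r).1 i then _ else _) (Finset.mem_univ u),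
    ← Finset.mul_prod_erase _ (fun i => if i < (cap t r).1 i then _ else _)
      (Finset.mem_erase.2 ⟨T.ne.symm, Finset.mem_univ v⟩),
    T.skip_u, T.skip_v, T.cap_u, T.cap_v, put_skip, put_skip, hh]
  have e : ∏ x ∈ (Finset.univ.erase u).erase v, (if skip t x < r.1 (skip t x) then
        (S (putHeight t (b u) b (skip t x)))⁻¹ else 1) =
      ∏ x ∈ (Finset.univ.erase u).erase v, if x < (cap t r).1 x then (S (b x))⁻¹ else 1 := by
    refine Finset.prod_congr rfl fun i hi => ?_
    simp only [Finset.mem_erase] at hi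
    rw [← T.skip_cap_of_ne hi.2.1 hi.1, put_skip]
    simp only [skip_lt]
  rw [e]
  generalize ∏ x ∈ (Finset.univ.erase u).erase v, (if x < (cap t r).1 x then (S (b x))⁻¹ else 1) = P
  have lt1 : NC2.lo t < skip t u ↔ (t : ℕ) ≤ u := by
    rw [Fin.lt_def, lo_val, skip_val]; split_ifs <;> omega
  have lt2 : NC2.hi t < skip t v ↔ (t : ℕ) ≤ v := by
    rw [Fin.lt_def, hi_val, skip_val]; split_ifs <;> omega
  have lt3 : skip t u < NC2.lo t ↔ (u : ℕ) < t := by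
    rw [Fin.lt_def, lo_val, skip_val]; split_ifs <;> omega
  have lt4 : skip t v < NC2.hi t ↔ (v : ℕ) < t := by
    rw [Fin.lt_def, hi_val, skip_val]; split_ifs <;> omega
  simp only [lt1, lt2, lt3, lt4, Fin.lt_def]
  have hc := T.cases
  simp only [Fin.lt_def] at hc
  rcases hc with h | h | h
  · rw [if_neg (by omega), if_pos (by omega), if_pos (by omega), if_neg (by omega),
      if_pos (by omega), if_neg (by omega)]
    field_simp
  · rw [if_neg (by omega), if_neg (by omega), if_pos (by omega), if_pos (by omega),
      if_neg (by omega), if_pos (by omega)]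
    field_simp
  · rw [if_pos (by omega), if_pos (by omega), if_neg (by omega), if_neg (by omega),
      if_neg (by omega), if_pos (by omega)]
    field_simp

end Turn

end compat

/-- Arc weights for the first pairing: the value at the inner height. -/
noncomputable def innerWeight (d : ℂ) (_ y : ℕ) : ℂ := chebS d y

/-- Arc weights for the second pairing: the inverse of the value at the outer height. -/
noncomputable def outerWeight (d : ℂ) (x _ : ℕ) : ℂ := (chebS d x)⁻¹

theorem pathCoeff_zero (F : ℕ → ℕ → ℂ) (p : NC2 0) (a : ℕ → ℕ) : pathCoeff F p a = 1 := by
  rw [pathCoeff, if_pos (show Compat p a from fun i => i.elim0), arcWeight]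
  exact Fintype.prod_empty (ι := Fin 0) _

instance : Unique (Walk 0) where
  default := ⟨fun _ => 0, rfl, fun i hi => by omega, fun _ _ => rfl⟩
  uniq a := Walk.ext (funext fun i => a.2.2.2 i (by omega))

/-- Inserting an interval into the first pairing weights the excursion by `S_y`. If `r` has the
interval, both excursions are allowed and `(S_{x+1} + S_{x-1}) / S_x = d` appears. Otherwise
compatibility fixes `y = b u`, and the only surviving term is a straightened strand of weight one.
-/
theorem outer_put_sum {n : ℕ} {d : ℂ} (hS : ∀ j ≤ n + 1, chebS d j ≠ 0) (t : Fin (2 * n + 1))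
    (r : NC2 (n + 1)) (b : Walk n) :
    chebS d (b.1 t + 1) * pathCoeff (outerWeight d) r (putHeight t (b.1 t + 1) b.1) +
      (if 0 < b.1 t then
        chebS d (b.1 t - 1) * pathCoeff (outerWeight d) r (putHeight t (b.1 t - 1) b.1) else 0) =
    d ^ (if r.1 (lo t) = hi t then 1 else 0) * pathCoeff (outerWeight d) (cap t r) b.1 := by
  have hb := fun i => hS (b.1 i) ((b.le_half i).trans (by omega))
  by_cases h : r.1 (lo t) = hi t
  · rw [if_pos h, pathCoeff_put _ h, pathCoeff_put _ h, pow_one]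
    have e := chebS_add (d := d) (b.1 t)
    have := hb t
    simp only [outerWeight]
    split_ifs at e ⊢
    · field_simp
      linear_combination pathCoeff (outerWeight d) (cap t r) b.1 * e
    · field_simp
      linear_combination pathCoeff (outerWeight d) (cap t r) b.1 * e
  · rw [if_neg h, pow_zero, one_mul]
    obtain ⟨u, v, T⟩ := exists_turn h
    by_cases H : Compat (cap t r) b.1
    · have hc : ∀ y, pathCoeff (outerWeight d) r (putHeight t y b.1) =
          if y = b.1 u then arcWeight (outerWeight d) r (putHeight t (b.1 u) b.1) else 0 := by
        intro y
        by_cases hy : y = b.1 u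
        · rw [pathCoeff, if_pos ((T.compat_put_iff y b.1).2 ⟨H, hy⟩), if_pos hy, hy]
        · rw [pathCoeff, if_neg fun h' => hy ((T.compat_put_iff y b.1).1 h').2, if_neg hy]
      have hh := T.height H
      have hv := b.2.2.1 u u.2
      have key := T.arcWeight_put H (hb u)
      rw [hh.2] at hv
      change chebS d (b.1 u) * arcWeight (outerWeight d) _ _ = arcWeight (outerWeight d) _ _ at key
      rw [hc, hc, pathCoeff, if_pos H, ← key]
      rcases hv with hv | hv
      · rw [if_neg (show ¬ b.1 t + 1 = b.1 u by omega), if_pos (show 0 < b.1 t by omega),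
          if_pos (show b.1 t - 1 = b.1 u by omega), show b.1 t - 1 = b.1 u by omega]
        ring
      · rw [if_pos hv.symm, ← hv]
        rw [if_neg (show ¬ b.1 t - 1 = b.1 u by omega)]
        simp
    · have hc : ∀ y, pathCoeff (outerWeight d) r (putHeight t y b.1) = 0 := fun y => by
        rw [pathCoeff, if_neg fun h' => H ((T.compat_put_iff y b.1).1 h').1]
      rw [hc, hc, pathCoeff, if_neg H]
      simp

/-- The path model of the Gram matrix. Induction on `p` by inserting an interval: only walks
returning at `t+2` to their height at `t` contribute, and the sum over their excursions is
`outer_put_sum`, matching `joinCard_ins`. -/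
theorem sum_pathCoeff {d : ℂ} (k : ℕ) (p : NC2 k) : (∀ j ≤ k, chebS d j ≠ 0) → ∀ q : NC2 k,
    ∑ a : Walk k, pathCoeff (innerWeight d) p a.1 * pathCoeff (outerWeight d) q a.1 =
      d ^ p.joinCard q := by
  refine ins_induction (P := fun k p => (∀ j ≤ k, chebS d j ≠ 0) → ∀ q : NC2 k,
    ∑ a : Walk k, pathCoeff (innerWeight d) p a.1 * pathCoeff (outerWeight d) q a.1 =
      d ^ p.joinCard q) ?_ ?_ k p
  · intro p _ q
    simp [pathCoeff_zero, joinCard_zero]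
  · intro n t s ih hS r
    rw [Walk.sum_put t, joinCard_ins, pow_add, ← ih (fun j hj => hS j (by omega)), Finset.sum_mul]
    · refine Finset.sum_congr rfl fun b _ => ?_
      have key := outer_put_sum hS t r b
      rw [mul_assoc, mul_comm (pathCoeff _ (cap t r) _), ← key]
      have hp : ∀ y h, pathCoeff (innerWeight d) (ins t s) (b.put t y h).1 =
          chebS d y * pathCoeff (innerWeight d) s b.1 := by
        intro y h
        change pathCoeff (innerWeight d) (ins t s) (putHeight t y b.1) = _
        rw [pathCoeff_put _ (ins_lo t s), cap_ins, innerWeight]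
      rw [hp, mul_add, mul_ite, mul_zero]
      congr 1
      · change _ * pathCoeff (outerWeight d) r (putHeight t _ b.1) = _
        ring
      · split_ifs with h
        · rw [hp]
          change _ * pathCoeff (outerWeight d) r (putHeight t _ b.1) = _
          ring
        · rfl
    · intro a ha
      rw [pathCoeff, if_neg, zero_mul]
      exact fun H => ha (H.eq_of_interval (ins_lo t s))

/-! ### Depth functions and triangularity. -/

/-- `a i` is the number of arcs of `p` above the gap before the point `i`. -/
def IsDepth {k : ℕ} (p : NC2 k) (a : ℕ → ℕ) : Prop :=
  Compat p a ∧ ∀ i, i < p.1 i → a (i + 1) = a i + 1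

section depth

variable {k n : ℕ}

theorem isDepth_put_iff (t : Fin (2 * n + 1)) (s : NC2 n) (b : ℕ → ℕ) (y : ℕ) :
    IsDepth (ins t s) (putHeight t y b) ↔ IsDepth s b ∧ y = b t + 1 := by
  rw [IsDepth, compat_put_iff (ins_lo t s), cap_ins, IsDepth, and_assoc]
  refine and_congr_right fun _ => ⟨fun h => ⟨fun i hi => ?_, ?_⟩, fun h => ?_⟩
  · have := h (skip t i) (by rwa [ins_skip, skip_lt])
    rwa [put_skip, put_skip_succ] at this
  · have := h (lo t) (by simp [ins_lo, Fin.lt_def])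
    rwa [put_lo, put_lo_succ] at this
  · refine forall_points t ?_ ?_ fun i hi => ?_
    · rw [put_lo, put_lo_succ]
      exact fun _ => h.2
    · rw [ins_hi]
      simp [Fin.lt_def]
    · rw [put_skip, put_skip_succ]
      rw [ins_skip, skip_lt] at hi
      exact h.1 i hi

theorem exists_isDepth (k : ℕ) (p : NC2 k) : ∃ a : Walk k, IsDepth p a.1 := by
  refine ins_induction (P := fun k p => ∃ a : Walk k, IsDepth p a.1) ?_ ?_ k p
  · exact fun p => ⟨default, fun i => i.elim0, fun i => i.elim0⟩
  · rintro n t s ⟨a, ha⟩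
    exact ⟨a.put t (a.1 t + 1) (Or.inl rfl), (isDepth_put_iff t s _ _).2 ⟨ha, rfl⟩⟩

/-- Crossing an arc inwards changes a compatible height by one, and the depth function always goes
up. This is the source of triangularity. -/
theorem IsDepth.le (k : ℕ) (p : NC2 k) : ∀ a b : Walk k, IsDepth p a.1 → Compat p b.1 → b ≤ a := by
  refine ins_induction (P := fun k p => ∀ a b : Walk k, IsDepth p a.1 → Compat p b.1 → b ≤ a)
    ?_ ?_ k p
  · intro p a b _ _
    rw [Subsingleton.elim a b]
  · intro n t s ih a b ha hb
    have h₁ := ha.1.eq_of_interval (ins_lo t s)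
    have h₂ := hb.eq_of_interval (ins_lo t s)
    have ha' := ha
    have hb' := hb
    rw [← put_del t _ h₁, isDepth_put_iff] at ha'
    rw [← put_del t _ h₂, compat_put_iff (ins_lo t s), cap_ins] at hb'
    have l := ih (a.del t h₁) (b.del t h₂) ha'.1 hb'
    refine fun i => del_le t h₁ h₂ ?_ l i
    have e := ha'.2
    have l' := l t
    have e' := b.2.2.1 t (by omega)
    simp only [Walk.del, delHeight, le_refl, if_true] at l' e
    omega

theorem exists_of_isDepth : ∀ (k : ℕ) (a : Walk k), ∃ p : NC2 k, IsDepth p a.1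
  | 0, a => ⟨NC2.empty, fun i => i.elim0, fun i => i.elim0⟩
  | n + 1, a => by
    -- A time of maximal height is a peak; the steps around it give an interval at `t = m - 1`,
    -- which is removed for the recursion.
    obtain ⟨m, hm, hmax⟩ := Finset.exists_max_image (Finset.range (2 * (n + 1) + 1)) a.1 ⟨0, by simp⟩
    rw [Finset.mem_range] at hm
    have h1 := hmax 1 (by simp)
    have e1 := a.2.2.1 0 (by omega)
    have e0 := a.2.1
    have hm0 : m ≠ 0 := by rintro rfl; simp at e1; omega
    have hm1 : m ≠ 2 * (n + 1) := fun h => by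
      have := a.2.2.2 m (by omega)
      simp at e1; omega
    let t : Fin (2 * n + 1) := ⟨m - 1, by omega⟩
    have ht : (t : ℕ) + 1 = m := by simp only [t]; omega
    have f1 := a.2.2.1 t (by omega)
    have f2 := a.2.2.1 (t + 1) (by omega)
    have g1 := hmax t (by rw [Finset.mem_range]; omega)
    have g2 := hmax (t + 2) (by rw [Finset.mem_range]; omega)
    rw [← ht] at g1 g2
    rw [show (t : ℕ) + 1 + 1 = t + 2 from rfl] at f2
    have h : a.1 t = a.1 (t + 2) := by omega
    obtain ⟨s, hs⟩ := exists_of_isDepth n (a.del t h)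
    refine ⟨ins t s, ?_⟩
    rw [← put_del t _ h, isDepth_put_iff]
    refine ⟨hs, ?_⟩
    simp only [delHeight, le_refl, if_true]
    omega

theorem IsDepth.inj (k : ℕ) (p : NC2 k) : ∀ (q : NC2 k) (a : Walk k), IsDepth p a.1 →
    IsDepth q a.1 → p = q := by
  refine ins_induction (P := fun k p => ∀ (q : NC2 k) (a : Walk k), IsDepth p a.1 →
    IsDepth q a.1 → p = q) ?_ ?_ k p
  · exact fun p q _ _ _ => Subtype.ext (funext fun i => i.elim0)
  · intro n t s ih r a ha hr
    have h := ha.1.eq_of_interval (ins_lo t s)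
    have ha' := ha
    rw [← put_del t _ h, isDepth_put_iff] at ha'
    have e : a.1 (t + 1) = a.1 t + 1 := by
      simpa only [delHeight, le_refl, if_true] using ha'.2
    have cl : ∀ i, r.1 i < i → a.1 i = a.1 (i + 1) + 1 := by
      intro i hi
      have h₁ := hr.2 (r.1 i) (by rwa [r.2.1])
      have h₂ := hr.1 i
      have h₃ := hr.1 (r.1 i)
      rw [r.2.1] at h₃
      omega
    have l1 : lo t < r.1 (lo t) := by
      refine lt_of_not_ge fun h' => ?_
      have := cl (lo t) (lt_of_le_of_ne h' (r.2.2.1 _))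
      simp only [lo_val] at this
      omega
    have l2 : r.1 (hi t) < hi t := by
      refine lt_of_not_ge fun h' => ?_
      have := hr.2 (hi t) (lt_of_le_of_ne h' (r.2.2.1 _).symm)
      simp only [hi_val] at this
      rw [show (t : ℕ) + 1 + 1 = t + 2 from rfl] at this
      omega
    -- At a peak of the depth, `t` opens an arc of `r` and `t+1` closes one; unless they are paired,
    -- the two arcs cross.
    have hint : r.1 (lo t) = hi t := by
      by_contra hne
      obtain ⟨u, v, T⟩ := exists_turn hne
      have c := r.2.2.2 (r.1 (hi t)) (lo t)
      rw [r.2.1] at c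
      have n1 : r.1 (hi t) ≠ lo t := fun h' => hne (by rw [← h', r.2.1])
      simp only [Fin.lt_def, Ne, Fin.ext_iff, lo_val, hi_val] at c l1 l2 n1 hne
      omega
    have hr' := hr
    rw [← ins_cap hint, ← put_del t _ h, isDepth_put_iff] at hr'
    rw [ih (cap t r) (a.del t h) ha'.1 hr'.1, ins_cap hint]

/-- The pairing with a given depth function. -/
noncomputable def ofWalk (k : ℕ) (a : Walk k) : NC2 k := (exists_of_isDepth k a).choose

theorem isDepth_ofWalk (a : Walk k) : IsDepth (ofWalk k a) a.1 := (exists_of_isDepth k a).choose_spec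

theorem ofWalk_bijective (k : ℕ) : Function.Bijective (ofWalk k) := by
  constructor
  · intro a b h
    have ha := isDepth_ofWalk a
    have hb := isDepth_ofWalk b
    rw [h] at ha
    exact le_antisymm (IsDepth.le _ _ _ _ hb ha.1) (IsDepth.le _ _ _ _ ha hb.1)
  · intro p
    obtain ⟨a, ha⟩ := exists_isDepth k p
    exact ⟨a, IsDepth.inj _ _ _ a (isDepth_ofWalk a) ha⟩

end depth

/-- In the row of a minimal index of the support of a kernel vector only the diagonal term survives.
-/
theorem Matrix.isUnit_of_triangular {ι : Type*} [Fintype ι] [DecidableEq ι] [PartialOrder ι]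
    {A : Matrix ι ι ℂ} (h : ∀ i j, A i j ≠ 0 → j ≤ i) (hd : ∀ i, A i i ≠ 0) : IsUnit A := by
  rw [Matrix.isUnit_iff_isUnit_det, isUnit_iff_ne_zero]
  intro h0
  obtain ⟨v, hv, hA⟩ := Matrix.exists_mulVec_eq_zero_iff.2 h0
  obtain ⟨j, hj⟩ := Function.ne_iff.1 hv
  obtain ⟨i, hi⟩ := (Set.toFinite {j | v j ≠ 0}).exists_minimal ⟨j, hj⟩
  have e := congrFun hA i
  rw [Matrix.mulVec, dotProduct, Finset.sum_eq_single i] at e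
  · exact mul_ne_zero (hd i) hi.prop e
  · intro b _ hb
    by_contra hne
    exact hb (le_antisymm (h i b (left_ne_zero_of_mul hne))
      (hi.le_of_le (right_ne_zero_of_mul hne) (h i b (left_ne_zero_of_mul hne))))
  · simp

theorem isUnit_pathCoeff {k : ℕ} {F : ℕ → ℕ → ℂ} (hF : ∀ x y, x ≤ k → y ≤ k → F x y ≠ 0)
    [DecidableEq (Walk k)] :
    IsUnit (Matrix.of fun a b : Walk k => pathCoeff F (ofWalk k a) b.1) := by
  refine Matrix.isUnit_of_triangular (fun a b h => ?_) fun a => ?_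
  · rw [Matrix.of_apply, pathCoeff] at h
    exact IsDepth.le _ _ _ _ (isDepth_ofWalk a) (by by_contra h'; exact h (if_neg h'))
  · rw [Matrix.of_apply, pathCoeff, if_pos (isDepth_ofWalk a).1, arcWeight]
    refine Finset.prod_ne_zero_iff.2 fun i _ => ?_
    split_ifs
    · exact hF _ _ (a.le_half _) (a.le_half _)
    · exact one_ne_zero

theorem isUnit_gramMatrix {k : ℕ} {d : ℂ} (hS : ∀ j ≤ k, chebS d j ≠ 0) :
    IsUnit (gramMatrix k d) := by
  classical
  let e := Equiv.ofBijective _ (ofWalk_bijective k)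
  rw [← Matrix.isUnit_submatrix_equiv e e]
  have h₁ := isUnit_pathCoeff (k := k) (F := innerWeight d) fun x y _ hy => hS y hy
  have h₂ := isUnit_pathCoeff (k := k) (F := outerWeight d) fun x y hx _ => inv_ne_zero (hS x hx)
  have := h₁.mul ((Matrix.isUnit_transpose _).2 h₂)
  convert this
  ext a b
  rw [Matrix.mul_apply]
  exact (sum_pathCoeff k _ hS _).symm

/-! ### The sign of the loop count. -/

section sign

variable {k : ℕ}

theorem pathCoeff_innerWeight_neg (d : ℂ) (p : NC2 k) (a : Walk k) :
    pathCoeff (innerWeight (-d)) p a.1 =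
      (∏ i : Fin (2 * k), if i < p.1 i then (-1) ^ ((i : ℕ) + 1) else 1) *
        pathCoeff (innerWeight d) p a.1 := by
  rw [pathCoeff, pathCoeff, mul_ite, mul_zero]
  congr 1
  rw [arcWeight, arcWeight, ← Finset.prod_mul_distrib]
  refine Finset.prod_congr rfl fun i _ => ?_
  split_ifs
  · rw [innerWeight, chebS_neg, a.neg_one_pow (by omega)]
    rfl
  · rw [one_mul]

theorem pathCoeff_outerWeight_neg (d : ℂ) (p : NC2 k) (a : Walk k) :
    pathCoeff (outerWeight (-d)) p a.1 =
      (∏ i : Fin (2 * k), if i < p.1 i then (-1) ^ (i : ℕ) else 1) *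
        pathCoeff (outerWeight d) p a.1 := by
  rw [pathCoeff, pathCoeff, mul_ite, mul_zero]
  congr 1
  rw [arcWeight, arcWeight, ← Finset.prod_mul_distrib]
  refine Finset.prod_congr rfl fun i _ => ?_
  split_ifs
  · rw [outerWeight, chebS_neg, a.neg_one_pow (by omega), mul_inv, ← inv_pow, inv_neg_one]
    rfl
  · rw [one_mul]

theorem norm_chebS_succ {d : ℂ} (hd : 2 ≤ ‖d‖) (j : ℕ) :
    0 < ‖chebS d j‖ ∧ ‖chebS d j‖ ≤ ‖chebS d (j + 1)‖ := by
  induction j with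
  | zero => simp [chebS]; linarith
  | succ j ih =>
    refine ⟨ih.1.trans_le ih.2, ?_⟩
    have h : ‖d * chebS d (j + 1)‖ ≤ ‖chebS d (j + 2)‖ + ‖chebS d j‖ := by
      have : d * chebS d (j + 1) = chebS d (j + 2) + chebS d j := by rw [chebS]; ring
      rw [this]
      exact norm_add_le _ _
    rw [norm_mul] at h
    have := mul_le_mul_of_nonneg_right hd (norm_nonneg (chebS d (j + 1)))
    change _ ≤ ‖chebS d (j + 2)‖
    linarith [ih.2]

theorem chebS_ne_zero_of_two_le {d : ℂ} (hd : 2 ≤ ‖d‖) (j : ℕ) : chebS d j ≠ 0 :=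
  norm_pos_iff.1 (norm_chebS_succ hd j).1

/-- The sign of the number of loops is a product of a sign for each of the two pairings. -/
theorem exists_sign (k : ℕ) : ∃ ε ε' : NC2 k → ℂ, ∀ p q, (-1) ^ p.joinCard q = ε p * ε' q := by
  refine ⟨fun p => ∏ i : Fin (2 * k), if i < p.1 i then (-1) ^ ((i : ℕ) + 1) else 1,
    fun q => ∏ i : Fin (2 * k), if i < q.1 i then (-1) ^ (i : ℕ) else 1, fun p q => ?_⟩
  -- The model at `-d` differs from that at `d` by signs independent of the walk, so they leave the
  -- sum. The value `2` is convenient because no `chebS` vanishes at `±2`.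
  have h₁ := sum_pathCoeff (d := 2) k p (fun j _ => chebS_ne_zero_of_two_le (by simp) j) q
  have h₂ := sum_pathCoeff (d := -2) k p (fun j _ => chebS_ne_zero_of_two_le (by simp) j) q
  rw [Finset.sum_congr rfl fun a _ => by
    rw [pathCoeff_innerWeight_neg, pathCoeff_outerWeight_neg, mul_mul_mul_comm]] at h₂
  rw [← Finset.mul_sum, h₁, neg_pow (2 : ℂ)] at h₂
  exact (mul_right_cancel₀ (pow_ne_zero _ two_ne_zero) h₂).symm

/-- Since the sign factorizes, the change from `p` to `r` is the same for every `q`; it is read off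
at `q = p`, where `|p ∨ p| = |r ∨ p| + 1`. -/
theorem neg_one_pow_joinCard_neighbor {p r : NC2 k} (h : p.Neighbor r) (q : NC2 k) :
    (-1 : ℂ) ^ r.joinCard q = -(-1) ^ p.joinCard q := by
  obtain ⟨t, h⟩ := h
  cases k with
  | zero => obtain ⟨-, a, -⟩ := h; exact a.elim0
  | succ n =>
    obtain ⟨t, rfl⟩ : ∃ t' : Fin (2 * n + 1), (t' : ℕ) = t := ⟨⟨t, h.1.lt⟩, rfl⟩
    have ht := (isInterval_iff t p).1 h.1
    obtain ⟨hr, hc⟩ := cap_of_neighbor h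
    have e₁ : p.joinCard p = r.joinCard p + 1 := by
      rw [joinCard_comm r p, ← ins_cap ht, joinCard_ins, joinCard_ins, if_neg hr, ins_cap ht,
        if_pos ht, hc]
    obtain ⟨ε, ε', hε⟩ := exists_sign (n + 1)
    have h₁ := hε p p
    have h₂ := hε r p
    rw [e₁, pow_succ] at h₁
    have hne : ε' p ≠ 0 := by
      intro h0
      rw [h0, mul_zero] at h₂
      exact pow_ne_zero _ (by norm_num) h₂
    have : ε r = - ε p := mul_right_cancel₀ hne (by rw [← h₂, neg_mul, ← h₁]; ring)
    rw [hε, hε, this, neg_mul]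

end sign

/-! ### Zeros of the Chebyshev polynomials. -/

theorem chebS_eq_eval (d : ℂ) : ∀ j : ℕ, chebS d j = (Polynomial.Chebyshev.S ℂ j).eval d
  | 0 => by simp [chebS]
  | 1 => by simp [chebS]
  | j + 2 => by
    rw [chebS, chebS_eq_eval d (j + 1), chebS_eq_eval d j]
    push_cast
    rw [Polynomial.Chebyshev.S_add_two]
    simp

/-- With `d = 2 cos θ`, a zero forces `sin((j+1)θ) = 0`. So `θ` is a real multiple of `π/(j+1)`, and
only its residue modulo `π` affects `|cos θ|`. -/
theorem norm_le_of_chebS_eq_zero {d : ℂ} {j : ℕ} (h : chebS d j = 0) :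
    ‖d‖ ≤ 2 * Real.cos (Real.pi / (j + 1)) := by
  obtain ⟨θ, hθ⟩ := Complex.cos_surjective (d / 2)
  have hd : d = 2 * Complex.cos θ := by rw [hθ]; ring
  have hN : (0 : ℝ) < j + 1 := by positivity
  have hNC : ((j : ℂ) + 1) ≠ 0 := by exact_mod_cast Nat.succ_ne_zero j
  have e := Polynomial.Chebyshev.S_two_mul_complex_cos θ j
  rw [← hd, ← chebS_eq_eval, h, zero_mul] at e
  obtain ⟨m, hm⟩ := Complex.sin_eq_zero_iff.1 e.symm
  push_cast at hm
  set N : ℤ := (j : ℤ) + 1 with hNdef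
  have hNpos : 0 < N := by omega
  have hm' : θ = ((m * Real.pi / (j + 1) : ℝ) : ℂ) := by
    push_cast
    field_simp
    linear_combination hm
  have hnorm : ‖d‖ = 2 * |Real.cos (m * Real.pi / (j + 1))| := by
    rw [hd, hm', ← Complex.ofReal_cos, norm_mul, Complex.norm_real, Real.norm_eq_abs]
    simp
  have hmod : (m * Real.pi / (j + 1) : ℝ) =
      (m % N : ℤ) * Real.pi / (j + 1) + (m / N : ℤ) * Real.pi := by
    have : (m : ℝ) = (m % N : ℤ) + (N : ℝ) * (m / N : ℤ) := by
      exact_mod_cast (Int.emod_add_mul_ediv m N).symm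
    have hN' : (N : ℝ) = j + 1 := by rw [hNdef]; push_cast; rfl
    rw [hN'] at this
    rw [this]
    field_simp
  rw [hmod, Real.cos_add_int_mul_pi, abs_mul, abs_zpow, abs_neg, abs_one, one_zpow, one_mul] at hnorm
  have hr0 := Int.emod_nonneg m hNpos.ne'
  have hr1 := Int.emod_lt_of_pos m hNpos
  generalize m % N = r at hnorm hr0 hr1
  -- Residue `0` is the degenerate case `sin θ = 0`, in which `|d| = 2` and `S_j(d)` does not
  -- vanish.
  rcases hr0.eq_or_lt with rfl | hr
  · exfalso
    simp only [Int.cast_zero, zero_mul, zero_div, Real.cos_zero, abs_one, mul_one] at hnorm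
    exact chebS_ne_zero_of_two_le hnorm.ge j h
  · rw [hnorm]
    have h1 : (1 : ℝ) ≤ r := by exact_mod_cast hr
    have h2 : (r : ℝ) ≤ j := by
      have : r ≤ j := by omega
      exact_mod_cast this
    have hpi := Real.pi_pos
    refine mul_le_mul_of_nonneg_left (abs_le.2 ⟨?_, ?_⟩) zero_le_two
    · rw [← Real.cos_pi_sub]
      refine Real.cos_le_cos_of_nonneg_of_le_pi (by positivity) ?_ ?_
      · have : 0 ≤ Real.pi / (j + 1) := by positivity
        linarith
      · rw [div_le_iff₀ hN, sub_mul, div_mul_cancel₀ _ hN.ne']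
        nlinarith
    · refine Real.cos_le_cos_of_nonneg_of_le_pi (by positivity) ?_ ?_
      · rw [div_le_iff₀ hN]
        nlinarith
      · gcongr
        nlinarith

theorem chebS_ne_zero {d : ℂ} {k : ℕ} (hd : 2 * Real.cos (Real.pi / (k + 1)) < ‖d‖) :
    ∀ j ≤ k, chebS d j ≠ 0 := by
  intro j hj h
  refine (norm_le_of_chebS_eq_zero h).not_gt (lt_of_le_of_lt ?_ hd)
  have hj' : (j : ℝ) ≤ k := by exact_mod_cast hj
  refine mul_le_mul_of_nonneg_left (Real.cos_le_cos_of_nonneg_of_le_pi (by positivity) ?_ ?_)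
    zero_le_two
  · exact div_le_self Real.pi_pos.le (by linarith [(Nat.cast_nonneg j : (0 : ℝ) ≤ j)])
  · gcongr

/-! ### Orthogonality relations. -/

section weingarten

variable {n : ℕ} {d : ℂ}

/-- The adjointness of `ins` and `cap` transported to inverse matrices: the smaller Gram matrix
applied to the fibre sums gives the rows `ins t s` of the larger Gram matrix times its inverse. -/
theorem sum_Wg_cap (h₀ : IsUnit (gramMatrix n d)) (h₁ : IsUnit (gramMatrix (n + 1) d))
    (t : Fin (2 * n + 1)) (p : NC2 n) (q : NC2 (n + 1)) :
    (∑ r, if cap t r = p then d ^ (if r.1 (lo t) = hi t then 1 else 0) * Wg (n + 1) d r q else 0) =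
      if q.1 (lo t) = hi t then Wg n d p (cap t q) else 0 := by
  rw [Matrix.isUnit_iff_isUnit_det] at h₀ h₁
  set X : NC2 n → ℂ := fun p => ∑ r, if cap t r = p then
    d ^ (if r.1 (lo t) = hi t then 1 else 0) * Wg (n + 1) d r q else 0 with hX
  have hG : (gramMatrix n d).mulVec X = fun s => if ins t s = q then 1 else 0 := by
    funext s
    have e : (1 : Matrix (NC2 (n + 1)) (NC2 (n + 1)) ℂ) (ins t s) q = if ins t s = q then 1 else 0 :=
      Matrix.one_apply
    rw [← Matrix.mul_nonsing_inv _ h₁, Matrix.mul_apply] at e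
    rw [← e, Matrix.mulVec, dotProduct]
    simp only [hX, Finset.mul_sum]
    rw [Finset.sum_comm]
    refine Finset.sum_congr rfl fun r _ => ?_
    rw [Finset.sum_eq_single (cap t r)]
    · rw [if_pos rfl, ← mul_assoc, gramMatrix, gramMatrix, Matrix.of_apply, Matrix.of_apply,
        joinCard_ins, pow_add]
      rfl
    · intro b _ hb
      rw [if_neg hb.symm, mul_zero]
    · simp
  change X p = _
  have : X = (Wg n d).mulVec fun s => if ins t s = q then 1 else 0 := by
    rw [← hG, Matrix.mulVec_mulVec, Wg, Matrix.nonsing_inv_mul _ h₀, Matrix.one_mulVec]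
  rw [this, Matrix.mulVec, dotProduct]
  by_cases h : q.1 (lo t) = hi t
  · rw [if_pos h, Finset.sum_eq_single (cap t q)]
    · rw [if_pos (ins_cap h), mul_one]
    · intro b _ hb
      rw [if_neg, mul_zero]
      rintro rfl
      exact hb (cap_ins t b).symm
    · simp
  · rw [if_neg h]
    refine Finset.sum_eq_zero fun s _ => ?_
    rw [if_neg, mul_zero]
    rintro rfl
    exact h (ins_lo t s)

/-- The orthogonality relation at `(p, q)` for an interval of `p`. -/
theorem Wg_relation (h₀ : IsUnit (gramMatrix n d)) (h₁ : IsUnit (gramMatrix (n + 1) d))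
    {t : Fin (2 * n + 1)} {p : NC2 (n + 1)} (ht : p.1 (lo t) = hi t) (q : NC2 (n + 1))
    [DecidablePred (NeighborAt (t : ℕ) p)] :
    d * Wg (n + 1) d p q + (∑ r with NeighborAt (t : ℕ) p r, Wg (n + 1) d r q) =
      if q.1 (lo t) = hi t then Wg n d (cap t p) (cap t q) else 0 := by
  classical
  -- The fibre of `cap t` over `cap t p` consists of `p`, which contributes the factor `d`, and of
  -- its neighbours at `t`, which contribute the factor `1`.
  rw [← sum_Wg_cap h₀ h₁, Finset.sum_filter, ← Finset.sum_erase_add _ _ (Finset.mem_univ p),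
    ← Finset.sum_erase_add (a := p) _ (fun r => if cap t r = cap t p then _ else _)
      (Finset.mem_univ p), if_pos rfl, if_pos ht, pow_one,
    if_neg fun h => (cap_of_neighbor h).1 ht, add_zero, add_comm]
  congr 1
  refine Finset.sum_congr rfl fun r hr => ?_
  have hr := Finset.ne_of_mem_erase hr
  by_cases hc : cap t r = cap t p
  · have hrt : r.1 (lo t) ≠ hi t := fun h => hr (by rw [← ins_cap h, hc, ins_cap ht])
    rw [if_pos hc, if_pos (neighbor_of_cap ht hrt hc), if_neg hrt, pow_zero, one_mul]
  · rw [if_neg hc, if_neg fun h => hc (cap_of_neighbor h).2]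

end weingarten

/-! ### Directed paths -/

section dipaths

variable {V : Type*} {G : Digraph V}

theorem cons_mem_dipaths {n : ℕ} {v w u : V} (h : G.Adj v w) {γ : Fin (n + 1) → V}
    (hγ : γ ∈ dipaths G n w u) : (Fin.cons v γ : Fin (n + 2) → V) ∈ dipaths G (n + 1) v u := by
  obtain ⟨h₀, h₁, h₂⟩ := hγ
  refine ⟨rfl, ?_, fun i => ?_⟩
  · rw [← Fin.succ_last, Fin.cons_succ, h₁]
  · refine Fin.cases ?_ (fun i => ?_) i
    · rw [Fin.castSucc_zero, Fin.cons_zero, Fin.cons_succ, h₀]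
      exact h
    · rw [← Fin.succ_castSucc, Fin.cons_succ, Fin.cons_succ]
      exact h₂ i

theorem tail_mem_dipaths {n : ℕ} {v u : V} {γ : Fin (n + 2) → V} (hγ : γ ∈ dipaths G (n + 1) v u) :
    G.Adj v (γ 1) ∧ Fin.tail γ ∈ dipaths G n (γ 1) u := by
  obtain ⟨h₀, h₁, h₂⟩ := hγ
  refine ⟨?_, rfl, ?_, fun i => ?_⟩
  · have := h₂ 0
    rwa [Fin.castSucc_zero, h₀] at this
  · rw [Fin.tail, Fin.succ_last, h₁]
  · have := h₂ i.succ
    rwa [← Fin.succ_castSucc] at this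

theorem dipaths_zero (v u : V) [DecidableEq V] :
    dipaths G 0 v u = if v = u then {fun _ => v} else ∅ := by
  ext γ
  have : γ ∈ dipaths G 0 v u ↔ γ 0 = v ∧ γ 0 = u :=
    ⟨fun h => ⟨h.1, h.2.1⟩, fun h => ⟨h.1, h.2, fun i => i.elim0⟩⟩
  rw [this]
  split_ifs with h
  · subst h
    rw [and_self, Set.mem_singleton_iff]
    exact ⟨fun h => funext fun i => by rw [Fin.fin_one_eq_zero i, h], fun h => by rw [h]⟩
  · simp only [Set.mem_empty_iff_false, iff_false]
    rintro ⟨h₁, h₂⟩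
    exact h (h₁.symm.trans h₂)

/-- Splitting off the first step of a path. -/
def dipathsSuccEquiv (G : Digraph V) (n : ℕ) (v u : V) :
    dipaths G (n + 1) v u ≃ Σ w : {w // G.Adj v w}, dipaths G n w.1 u where
  toFun γ := ⟨⟨γ.1 1, (tail_mem_dipaths γ.2).1⟩, ⟨Fin.tail γ.1, (tail_mem_dipaths γ.2).2⟩⟩
  invFun x := ⟨Fin.cons v x.2.1, cons_mem_dipaths x.1.2 x.2.2⟩
  left_inv γ := Subtype.ext (by
    have h := γ.2.1
    change Fin.cons v (Fin.tail γ.1) = γ.1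
    exact (congrArg (fun x => Fin.cons x (Fin.tail γ.1)) h.symm).trans (Fin.cons_self_tail γ.1))
  right_inv := by
    rintro ⟨⟨w, hw⟩, ⟨γ, hγ⟩⟩
    obtain rfl : γ 0 = w := hγ.1
    rfl

theorem finite_dipaths (hG : ∀ v, {w | G.Adj v w}.Finite) (n : ℕ) (v u : V) :
    (dipaths G n v u).Finite := by
  classical
  induction n generalizing v with
  | zero =>
    rw [dipaths_zero]
    split_ifs
    · exact Set.finite_singleton _
    · exact Set.finite_empty
  | succ n ih =>
    have := fun w => (ih w).to_subtype
    have : Finite {w // G.Adj v w} := (hG v).to_subtype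
    exact Set.finite_coe_iff.1 (Finite.of_equiv _ (dipathsSuccEquiv G n v u).symm)

theorem ncard_dipaths_succ (hG : ∀ v, {w | G.Adj v w}.Finite) (n : ℕ) (v u : V) :
    (dipaths G (n + 1) v u).ncard = ∑ w ∈ (hG v).toFinset, (dipaths G n w u).ncard := by
  have := fun w => (finite_dipaths hG n w u).to_subtype
  have : Finite {w // G.Adj v w} := (hG v).to_subtype
  have : Fintype {w // G.Adj v w} := Fintype.ofFinite _
  rw [← Nat.card_coe_set_eq, Nat.card_congr (dipathsSuccEquiv G n v u), Nat.card_sigma]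
  simp only [Nat.card_coe_set_eq]
  exact (Finset.sum_subtype (hG v).toFinset (fun w => by simp)
    (fun w => (dipaths G n w u).ncard)).symm

end dipaths

/-! ### Orthogonality relations as sums over edges -/

section relations

theorem leftRelation_iff {n : ℕ} (t : Fin (2 * n + 1)) (p q : NC2 (n + 1)) (w : WgVertex) :
    LeftRelation t ⟨n + 1, p, q⟩ w ↔ (∃ r, NeighborAt t p r ∧ w = ⟨n + 1, r, q⟩) ∨
      (p.1 (lo t) = hi t ∧ q.1 (lo t) = hi t ∧ w = ⟨n, cap t p, cap t q⟩) := by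
  constructor
  · rintro (h | ⟨h, h'⟩)
    · exact Or.inl ⟨_, h, rfl⟩
    · rw [removal_iff] at h h'
      exact Or.inr ⟨h.1, h'.1, by rw [h.2, h'.2]⟩
  · rintro (⟨r, h, rfl⟩ | ⟨h, h', rfl⟩)
    · exact LeftRelation.neighbor h
    · exact LeftRelation.remove ((removal_iff _ _ _).2 ⟨h, rfl⟩) ((removal_iff _ _ _).2 ⟨h', rfl⟩)

/-- Exchange the two pairings of a vertex. -/
def WgVertex.swap (v : WgVertex) : WgVertex := ⟨v.1, v.2.2, v.2.1⟩

theorem WgVertex.swap_swap (v : WgVertex) : v.swap.swap = v := rfl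

theorem rightRelation_iff (t : ℕ) (v w : WgVertex) :
    RightRelation t v w ↔ LeftRelation t v.swap w.swap := by
  constructor
  · rintro (h | ⟨h, h'⟩)
    · exact LeftRelation.neighbor h
    · exact LeftRelation.remove h' h
  · intro h
    rw [← v.swap_swap, ← w.swap_swap]
    generalize v.swap = v at h
    generalize w.swap = w at h
    rcases h with h | ⟨h, h'⟩
    · exact RightRelation.neighbor h
    · exact RightRelation.remove h' h

theorem LeftRelation.edge {t : ℕ} {v w : WgVertex} (h : LeftRelation t v w) : WgEdge v w := by
  rcases h with h | ⟨h, h'⟩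
  · exact WgEdge.left ⟨t, h⟩
  · exact WgEdge.remove t h h'

theorem RightRelation.edge {t : ℕ} {v w : WgVertex} (h : RightRelation t v w) : WgEdge v w := by
  rcases h with h | ⟨h, h'⟩
  · exact WgEdge.right ⟨t, h⟩
  · exact WgEdge.remove t h h'

theorem WgEdge.level_le {v w : WgVertex} (h : WgEdge v w) : w.1 ≤ v.1 := by
  rcases h with _ | _ | _
  · exact le_rfl
  · exact le_rfl
  · exact Nat.le_succ _

/-- The sign `(-1) ^ |p ∨ q|` of a vertex. -/
noncomputable def loopSign (v : WgVertex) : ℂ := (-1) ^ v.2.1.joinCard v.2.2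

theorem loopSign_mul_self (v : WgVertex) : loopSign v * loopSign v = 1 := by
  rw [loopSign, ← mul_pow]
  simp

theorem joinCard_removal {n : ℕ} {t : ℕ} {p q : NC2 (n + 1)} {p' q' : NC2 n} (h : Removal t p p')
    (h' : Removal t q q') : p.joinCard q = p'.joinCard q' + 1 := by
  obtain ⟨t, rfl⟩ : ∃ t' : Fin (2 * n + 1), (t' : ℕ) = t := ⟨⟨t, h.1.lt⟩, rfl⟩
  rw [removal_iff] at h h'
  rw [h.2, h'.2, ← ins_cap h.1, joinCard_ins, if_pos h'.1, cap_ins]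

/-- A neighbour step flips the parity of the loop count and a removal deletes one loop, so path
lengths between two vertices have a fixed parity. -/
theorem WgEdge.loopSign_eq {v w : WgVertex} (h : WgEdge v w) : loopSign w = -loopSign v := by
  rcases h with h | h | ⟨t, h, h'⟩
  · exact neg_one_pow_joinCard_neighbor h _
  · simp only [loopSign]
    rw [joinCard_comm, neg_one_pow_joinCard_neighbor h, joinCard_comm]
  · simp only [loopSign]
    rw [joinCard_removal h h', pow_succ]
    ring

/-- The Weingarten matrix with the sign that makes its expansion coefficients nonnegative. -/
noncomputable def signedWg (d : ℂ) (v : WgVertex) : ℂ :=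
  (-1) ^ (v.2.1.joinCard v.2.2 + v.1) * Wg v.1 d v.2.1 v.2.2

theorem Wg_eq_signedWg (d : ℂ) (k : ℕ) (p q : NC2 k) :
    Wg k d p q = (-1) ^ (p.joinCard q + k) * signedWg d ⟨k, p, q⟩ := by
  rw [signedWg, ← mul_assoc, ← mul_pow]
  simp

theorem signedWg_swap (d : ℂ) (v : WgVertex) : signedWg d v.swap = signedWg d v := by
  simp only [signedWg, WgVertex.swap]
  rw [joinCard_comm, Wg_comm]

/-- Neighbours change sign at fixed `k`, which cancels the minus sign from moving them across the
relation. A removal lowers both the loop count and `k` by one and keeps the sign. -/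
theorem sum_leftRelation {d : ℂ} (hG : ∀ k, IsUnit (gramMatrix k d)) {v : WgVertex} {t : ℕ}
    (ht : v.2.1.IsInterval t) (out : Finset WgVertex) (hout : ∀ w, w ∈ out ↔ LeftRelation t v w) :
    d * signedWg d v = ∑ w ∈ out, signedWg d w := by
  classical
  obtain ⟨k, p, q⟩ := v
  cases k with
  | zero => obtain ⟨a, -⟩ := ht; exact a.elim0
  | succ n =>
  obtain ⟨t, rfl⟩ : ∃ t' : Fin (2 * n + 1), (t' : ℕ) = t := ⟨⟨t, ht.lt⟩, rfl⟩
  have ht' := (isInterval_iff t p).1 ht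
  have hW := Wg_relation (hG n) (hG (n + 1)) ht' q
  have e : out = (Finset.univ.filter (NeighborAt (t : ℕ) p)).image
      (fun r => (⟨n + 1, r, q⟩ : WgVertex)) ∪
      if q.1 (lo t) = hi t then {⟨n, cap t p, cap t q⟩} else ∅ := by
    ext w
    rw [hout, leftRelation_iff, Finset.mem_union, Finset.mem_image]
    refine or_congr ?_ ?_
    · simp [eq_comm]
    · split_ifs with h <;> simp [h, ht']
  rw [e, Finset.sum_union, Finset.sum_image]
  · have s₁ : ∑ r ∈ Finset.univ.filter (NeighborAt (t : ℕ) p), signedWg d ⟨n + 1, r, q⟩ =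
        -(-1) ^ (p.joinCard q + (n + 1)) *
          ∑ r ∈ Finset.univ.filter (NeighborAt (t : ℕ) p), Wg (n + 1) d r q := by
      rw [Finset.mul_sum]
      refine Finset.sum_congr rfl fun r hr => ?_
      rw [signedWg, pow_add, neg_one_pow_joinCard_neighbor ⟨t, (Finset.mem_filter.1 hr).2⟩, pow_add]
      ring
    have s₂ : ∑ w ∈ (if q.1 (lo t) = hi t then {(⟨n, cap t p, cap t q⟩ : WgVertex)} else ∅),
        signedWg d w = (-1) ^ (p.joinCard q + (n + 1)) *
          if q.1 (lo t) = hi t then Wg n d (cap t p) (cap t q) else 0 := by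
      split_ifs with h
      · rw [Finset.sum_singleton, signedWg, joinCard_removal ((removal_iff _ _ _).2 ⟨ht', rfl⟩)
          ((removal_iff _ _ _).2 ⟨h, rfl⟩)]
        ring
      · simp
    rw [s₁, s₂, ← hW, signedWg]
    ring
  · intro r _ r' _ h
    simpa using h
  · rw [Finset.disjoint_left]
    intro w hw hw'
    obtain ⟨r, -, rfl⟩ := Finset.mem_image.1 hw
    split_ifs at hw'
    · have := congrArg Sigma.fst (Finset.mem_singleton.1 hw')
      simp at this
    · simp at hw'

theorem sum_rightRelation {d : ℂ} (hG : ∀ k, IsUnit (gramMatrix k d)) {v : WgVertex} {t : ℕ}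
    (ht : v.2.2.IsInterval t) (out : Finset WgVertex) (hout : ∀ w, w ∈ out ↔ RightRelation t v w) :
    d * signedWg d v = ∑ w ∈ out, signedWg d w := by
  classical
  have h := sum_leftRelation hG (v := v.swap) ht (out.image WgVertex.swap) (fun w => by
    rw [Finset.mem_image]
    constructor
    · rintro ⟨w, hw, rfl⟩
      exact (rightRelation_iff t v w).1 ((hout w).1 hw)
    · exact fun hw => ⟨w.swap, (hout _).2 ((rightRelation_iff t v _).2 hw), rfl⟩)
  rw [signedWg_swap, Finset.sum_image] at h
  · rw [h]
    exact Finset.sum_congr rfl fun w _ => signedWg_swap d w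
  · intro w _ w' _ h
    rw [← w.swap_swap, h, w'.swap_swap]

theorem signedWg_empty (d : ℂ) : signedWg d emptyVertex = 1 := by
  have h : gramMatrix 0 d = 1 := by
    ext p q
    have : p = q := Subtype.ext (funext fun i => i.elim0)
    subst this
    rw [gramMatrix, Matrix.of_apply, joinCard_zero, pow_zero, Matrix.one_apply_eq]
  change (-1) ^ (NC2.empty.joinCard NC2.empty + 0) * (gramMatrix 0 d)⁻¹ NC2.empty NC2.empty = 1
  rw [h, joinCard_zero, inv_one, Matrix.one_apply_eq]
  simp

theorem eq_emptyVertex (p q : NC2 0) : (⟨0, p, q⟩ : WgVertex) = emptyVertex := by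
  have h : ∀ p : NC2 0, p = NC2.empty := fun p => Subtype.ext (funext fun i => i.elim0)
  rw [h p, h q]
  rfl

theorem finite_level (K : ℕ) : {w : WgVertex | w.1 ≤ K}.Finite := by
  have : {w : WgVertex | w.1 ≤ K} =
      ⋃ k ∈ Finset.range (K + 1), Set.range fun x : NC2 k × NC2 k => (⟨k, x⟩ : WgVertex) := by
    ext ⟨k, x⟩
    simp only [Set.mem_ofPred_eq, Finset.mem_range, Set.mem_iUnion, Set.mem_range]
    constructor
    · exact fun h => ⟨k, by omega, x, rfl⟩
    · rintro ⟨k', hk, y, h⟩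
      have := congrArg Sigma.fst h
      simp only at this
      omega
  rw [this]
  exact Set.Finite.biUnion (Finset.finite_toSet _) fun _ _ => Set.finite_range _

theorem loopSign_of_dipath {G : Digraph WgVertex} (hG : ∀ v w, G.Adj v w → WgEdge v w) {n : ℕ}
    {v u : WgVertex} (h : (dipaths G n v u).Nonempty) : loopSign u = (-1) ^ n * loopSign v := by
  classical
  induction n generalizing v with
  | zero =>
    rw [dipaths_zero] at h
    split_ifs at h with h'
    · rw [h']; simp
    · exact (Set.not_nonempty_empty h).elim
  | succ n ih =>
    obtain ⟨γ, hγ⟩ := h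
    obtain ⟨h₁, h₂⟩ := tail_mem_dipaths hγ
    rw [ih ⟨_, h₂⟩, (hG _ _ h₁).loopSign_eq]
    ring

end relations

/-! ### Weingarten subgraphs -/

namespace IsWeingartenSubgraph

variable {H : Digraph WgVertex} (hH : IsWeingartenSubgraph H)
include hH

theorem edge {v w : WgVertex} (h : H.Adj v w) : WgEdge v w := by
  have hv : v ≠ emptyVertex := by rintro rfl; exact hH.1 w h
  obtain ⟨⟨t, ⟨-, ht⟩ | ⟨-, ht⟩⟩, -⟩ := hH.2 v hv
  · exact ((ht w).1 h).edge
  · exact ((ht w).1 h).edge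

theorem finite_out (v : WgVertex) : {w | H.Adj v w}.Finite :=
  (finite_level v.1).subset fun _ h => (hH.edge h).level_le

theorem mul_signedWg {d : ℂ} (hG : ∀ k, IsUnit (gramMatrix k d)) {v : WgVertex}
    (hv : v ≠ emptyVertex) :
    d * signedWg d v = ∑ w ∈ (hH.finite_out v).toFinset, signedWg d w := by
  obtain ⟨⟨t, ⟨ht, h⟩ | ⟨ht, h⟩⟩, -⟩ := hH.2 v hv
  · exact sum_leftRelation hG ht _ fun w => by simp [h]
  · exact sum_rightRelation hG ht _ fun w => by simp [h]

theorem dipaths_subset (n : ℕ) (v u : WgVertex) : dipaths H n v u ⊆ dipaths weingartenGraph n v u :=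
  fun _ h => ⟨h.1, h.2.1, fun i => hH.edge (h.2.2 i)⟩

/-- Each vertex has an edge of `H` that lowers the distance; following such edges gives a shortest
path inside `H`. -/
theorem nonempty_dipaths_wgDist (v : WgVertex) : (dipaths H (wgDist v) v emptyVertex).Nonempty := by
  classical
  induction hn : wgDist v generalizing v with
  | zero =>
    -- The default `sInf ∅ = 0` could make the distance `0` at a vertex without paths. The
    -- definition of a Weingarten subgraph excludes this: at other vertices the distance is a
    -- successor.
    have hv : v = emptyVertex := by
      by_contra hv
      obtain ⟨-, w, -, hw⟩ := hH.2 v hv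
      omega
    rw [dipaths_zero, if_pos hv]
    exact Set.singleton_nonempty _
  | succ n ih =>
    have hv : v ≠ emptyVertex := by
      rintro rfl
      have : wgDist emptyVertex ≤ 0 := Nat.sInf_le (by
        rw [Set.mem_ofPred_eq, dipaths_zero, if_pos rfl]
        exact Set.singleton_nonempty _)
      omega
    obtain ⟨-, w, hvw, hw⟩ := hH.2 v hv
    obtain ⟨γ, hγ⟩ := ih w (by omega)
    exact ⟨_, cons_mem_dipaths hvw hγ⟩

theorem exists_of_nonempty_dipaths {n : ℕ} {v : WgVertex}
    (h : (dipaths H n v emptyVertex).Nonempty) : ∃ r, n = wgDist v + 2 * r := by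
  have h₁ := loopSign_of_dipath (fun _ _ h => hH.edge h) h
  have h₂ := loopSign_of_dipath (fun _ _ h => hH.edge h) (hH.nonempty_dipaths_wgDist v)
  have hle : wgDist v ≤ n := Nat.sInf_le (h.mono (hH.dipaths_subset n v _))
  have h₃ : (-1 : ℂ) ^ n = (-1) ^ wgDist v := by
    have := h₁.symm.trans h₂
    have e := congrArg (· * loopSign v) this
    simpa only [mul_assoc, loopSign_mul_self, mul_one] using e
  obtain ⟨m, rfl⟩ := Nat.exists_eq_add_of_le hle
  rw [pow_add, mul_eq_left₀ (pow_ne_zero _ (by norm_num))] at h₃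
  have hev : Even m := by
    by_contra hodd
    rw [Nat.not_even_iff_odd] at hodd
    rw [hodd.neg_one_pow] at h₃
    norm_num at h₃
  obtain ⟨r, rfl⟩ := hev
  exact ⟨r, by omega⟩

end IsWeingartenSubgraph

/-- The number of directed paths of length `n` from `v` to `(∅, ∅)` in `H`. -/
noncomputable def dipathCount (H : Digraph WgVertex) (v : WgVertex) (n : ℕ) : ℕ :=
  (dipaths H n v emptyVertex).ncard

theorem dipathCount_zero {H : Digraph WgVertex} {v : WgVertex} (hv : v ≠ emptyVertex) : dipathCount H v 0 = 0 := by
  classical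
  rw [dipathCount, dipaths_zero, if_neg hv, Set.ncard_empty]

namespace IsWeingartenSubgraph

variable {H : Digraph WgVertex} (hH : IsWeingartenSubgraph H)
include hH

theorem dipathCount_succ (v : WgVertex) (n : ℕ) :
    dipathCount H v (n + 1) = ∑ w ∈ (hH.finite_out v).toFinset, dipathCount H w n :=
  ncard_dipaths_succ hH.finite_out n v emptyVertex

theorem dipathCount_empty (n : ℕ) : dipathCount H emptyVertex n = if n = 0 then 1 else 0 := by
  classical
  cases n with
  | zero => simp [dipathCount, dipaths_zero]
  | succ n =>
    rw [hH.dipathCount_succ, if_neg (Nat.succ_ne_zero n)]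
    have : (hH.finite_out emptyVertex).toFinset = ∅ := by
      ext w
      simp [hH.1 w]
    rw [this, Finset.sum_empty]

/-- For large `|d|`, iterating the orthogonality relations expands the Weingarten matrix. -/
theorem exists_hasSum_large (v : WgVertex) : ∃ R : ℝ, 2 ≤ R ∧ ∀ d : ℂ, R < ‖d‖ →
    HasSum (fun n => (dipathCount H v n : ℂ) * d⁻¹ ^ n) (signedWg d v) := by
  classical
  -- Edges never raise the level, so `B` contains everything reachable from `v`; its size bounds the
  -- out-degrees.
  set B := (finite_level v.1).toFinset with hB
  have memB : ∀ w, w ∈ B ↔ w.1 ≤ v.1 := fun w => by simp [hB]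
  have outB : ∀ w ∈ B, (hH.finite_out w).toFinset ⊆ B := by
    intro w hw u hu
    rw [Set.Finite.mem_toFinset] at hu
    rw [memB] at hw ⊢
    exact (hH.edge hu).level_le.trans hw
  have count_le : ∀ n, ∀ w ∈ B, dipathCount H w n ≤ B.card ^ n := by
    intro n
    induction n with
    | zero =>
      intro w _
      by_cases hw : w = emptyVertex
      · rw [hw, hH.dipathCount_empty, if_pos rfl, pow_zero]
      · rw [dipathCount_zero hw]; exact Nat.zero_le _
    | succ n ih =>
      intro w hw
      rw [hH.dipathCount_succ, pow_succ, mul_comm]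
      refine (Finset.sum_le_sum fun u hu => ih u (outB w hw hu)).trans ?_
      rw [Finset.sum_const, smul_eq_mul]
      exact Nat.mul_le_mul_right _ (Finset.card_le_card (outB w hw))
  -- The bound `2` makes the Gram matrices of all levels invertible; the bound `B.card` makes the
  -- remainder decay.
  refine ⟨max 2 B.card, le_max_left _ _, fun d hd => ?_⟩
  have hd2 : 2 < ‖d‖ := (le_max_left _ _).trans_lt hd
  have hdB : (B.card : ℝ) < ‖d‖ := (le_max_right _ _).trans_lt hd
  have hd0 : 0 < ‖d‖ := by linarith
  have hdne : d ≠ 0 := norm_pos_iff.1 hd0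
  have hG : ∀ k, IsUnit (gramMatrix k d) :=
    fun k => isUnit_gramMatrix fun j _ => chebS_ne_zero_of_two_le hd2.le j
  set θ : ℝ := B.card * ‖d⁻¹‖ with hθ
  have hθ0 : 0 ≤ θ := by positivity
  have hθ1 : θ < 1 := by
    rw [hθ, norm_inv, ← div_eq_mul_inv, div_lt_one hd0]
    exact hdB
  obtain ⟨M, hM⟩ : ∃ M : ℝ, ∀ w ∈ B, ‖signedWg d w‖ ≤ M :=
    ⟨∑ w ∈ B, ‖signedWg d w‖, fun w hw =>
      Finset.single_le_sum (f := fun w => ‖signedWg d w‖) (fun _ _ => norm_nonneg _) hw⟩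
  -- Each use of the relation costs a factor `d⁻¹` and branches at most `B.card` times, hence the
  -- ratio `θ`. At the empty vertex the expansion stops with the exact value `1`.
  have approx : ∀ n, ∀ w ∈ B, ‖signedWg d w -
      ∑ j ∈ Finset.range n, (dipathCount H w j : ℂ) * d⁻¹ ^ j‖ ≤ θ ^ n * M := by
    intro n
    induction n with
    | zero => intro w hw; simpa using hM w hw
    | succ n ih =>
      intro w hw
      have hM0 : 0 ≤ M := (norm_nonneg _).trans (hM w hw)
      by_cases hwe : w = emptyVertex
      · rw [Finset.sum_range_succ', hwe, signedWg_empty]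
        simp only [hH.dipathCount_empty]
        simp only [Nat.succ_ne_zero, if_false, Nat.cast_zero, zero_mul, Finset.sum_const_zero,
          if_true, Nat.cast_one, pow_zero, mul_one, zero_add, sub_self, norm_zero]
        positivity
      · have e : signedWg d w - ∑ j ∈ Finset.range (n + 1), (dipathCount H w j : ℂ) * d⁻¹ ^ j =
            d⁻¹ * ∑ u ∈ (hH.finite_out w).toFinset, (signedWg d u -
              ∑ j ∈ Finset.range n, (dipathCount H u j : ℂ) * d⁻¹ ^ j) := by
          rw [Finset.sum_sub_distrib, ← hH.mul_signedWg hG hwe, mul_sub, inv_mul_cancel_left₀ hdne,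
            Finset.sum_range_succ', dipathCount_zero hwe, Nat.cast_zero, zero_mul, add_zero,
            Finset.sum_comm, Finset.mul_sum]
          congr 1
          refine Finset.sum_congr rfl fun j _ => ?_
          rw [hH.dipathCount_succ, Nat.cast_sum, Finset.sum_mul, Finset.mul_sum]
          refine Finset.sum_congr rfl fun u _ => ?_
          rw [pow_succ]
          ring
        rw [e, norm_mul]
        have : ‖∑ u ∈ (hH.finite_out w).toFinset, (signedWg d u -
              ∑ j ∈ Finset.range n, (dipathCount H u j : ℂ) * d⁻¹ ^ j)‖ ≤ B.card * (θ ^ n * M) := by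
          refine (norm_sum_le _ _).trans
            ((Finset.sum_le_sum fun u hu => ih u (outB w hw hu)).trans ?_)
          rw [Finset.sum_const, nsmul_eq_mul]
          have hc : ((hH.finite_out w).toFinset.card : ℝ) ≤ B.card := by
            exact_mod_cast Finset.card_le_card (outB w hw)
          exact mul_le_mul_of_nonneg_right hc (by positivity)
        calc _ ≤ ‖d⁻¹‖ * (B.card * (θ ^ n * M)) := mul_le_mul_of_nonneg_left this (norm_nonneg _)
          _ = θ ^ (n + 1) * M := by rw [pow_succ, hθ]; ring
  have hv : v ∈ B := (memB v).2 le_rfl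
  have hs : Summable fun n => (dipathCount H v n : ℂ) * d⁻¹ ^ n := by
    refine Summable.of_norm_bounded (summable_geometric_of_lt_one hθ0 hθ1) fun n => ?_
    rw [norm_mul, norm_pow, hθ, mul_pow, Complex.norm_natCast]
    refine mul_le_mul_of_nonneg_right ?_ (by positivity)
    exact_mod_cast count_le n v hv
  refine (hs.hasSum_iff_tendsto_nat).2 (tendsto_iff_norm_sub_tendsto_zero.2 ?_)
  refine squeeze_zero (fun n => norm_nonneg _) (fun n => ?_)
    (by simpa using (tendsto_pow_atTop_nhds_zero_of_lt_one hθ0 hθ1).mul_const M)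
  rw [norm_sub_rev]
  exact approx n v hv

end IsWeingartenSubgraph

/-! ### Analytic continuation from large `|d|`. -/

open Filter Topology

/-- An expansion at infinity converges on every disc complement on which the function is
holomorphic. -/
theorem hasSum_of_hasSum_large {f : ℂ → ℂ} {c : ℕ → ℂ} {R ρ : ℝ} (hR : 0 < R)
    (hlarge : ∀ d : ℂ, R < ‖d‖ → HasSum (fun n => c n * d⁻¹ ^ n) (f d))
    (hf : ∀ d : ℂ, ρ < ‖d‖ → DifferentiableAt ℂ f d) {d : ℂ} (hd : ρ < ‖d‖) (hd₀ : d ≠ 0) :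
    HasSum (fun n => c n * d⁻¹ ^ n) (f d) := by
  classical
  obtain ⟨s, hs, hsd⟩ := exists_between (max_lt hd (norm_pos_iff.2 hd₀))
  obtain ⟨hsρ, hs₀⟩ := max_lt_iff.1 hs
  obtain ⟨r, hr⟩ : ∃ r : NNReal, (r : ℝ) = s⁻¹ := ⟨Real.toNNReal s⁻¹, Real.coe_toNNReal _ (by positivity)⟩
  -- `F` is `f` in the coordinate `z = d⁻¹`, filled in at `0`. It is holomorphic on the closed disc
  -- of radius `1/s`, so its Cauchy series converges on the open disc, which contains `d⁻¹`; by
  -- uniqueness that series has the coefficients `c`.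
  let F : ℂ → ℂ := fun z => if z = 0 then c 0 else f z⁻¹
  have hF : HasFPowerSeriesAt F (FormalMultilinearSeries.ofScalars ℂ c) 0 := by
    rw [hasFPowerSeriesAt_iff]
    filter_upwards [Metric.ball_mem_nhds (0 : ℂ) (inv_pos.2 hR)] with z hz
    rw [mem_ball_zero_iff] at hz
    simp only [FormalMultilinearSeries.coeff_ofScalars, smul_eq_mul, zero_add]
    by_cases hz₀ : z = 0
    · simp only [F, if_pos hz₀]
      have := hasSum_single (f := fun n => z ^ n * c n) 0 fun n hn => by simp [hz₀, hn]
      simpa using this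
    · simp only [F, if_neg hz₀]
      have := hlarge z⁻¹ (by
        rw [norm_inv]
        exact (lt_inv_comm₀ (norm_pos_iff.2 hz₀) hR).1 hz)
      simpa [mul_comm] using this
  have hdiff : DifferentiableOn ℂ F (Metric.closedBall 0 r) := by
    intro z hz
    rw [mem_closedBall_zero_iff, hr] at hz
    refine DifferentiableAt.differentiableWithinAt ?_
    by_cases hz₀ : z = 0
    · rw [hz₀]
      exact hF.analyticAt.differentiableAt
    · have hz' : ρ < ‖z⁻¹‖ := by
        rw [norm_inv]
        exact hsρ.trans_le ((le_inv_comm₀ (norm_pos_iff.2 hz₀) hs₀).1 hz)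
      have : DifferentiableAt ℂ (fun z => f z⁻¹) z :=
        (hf _ hz').comp z (differentiableAt_inv hz₀)
      refine this.congr_of_eventuallyEq ?_
      filter_upwards [isOpen_ne.mem_nhds hz₀] with w hw
      exact if_neg hw
  have hball := hdiff.hasFPowerSeriesOnBall (by
    rw [← NNReal.coe_pos, hr]; exact inv_pos.2 hs₀)
  rw [hball.hasFPowerSeriesAt.eq_formalMultilinearSeries hF] at hball
  have := hball.hasSum (y := d⁻¹) (by
    rw [Metric.eball_coe, mem_ball_zero_iff, hr, norm_inv]
    exact (inv_lt_inv₀ (hs₀.trans hsd) hs₀).2 hsd)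
  simpa [FormalMultilinearSeries.ofScalars_apply_eq, F, hd₀, mul_comm] using this

/-- After division by `z^L`, with `z = d⁻¹`, the expansion is a power series in `z` with constant
term `c L`, continuous at `z = 0`. -/
theorem tendsto_tail_of_hasSum_large {f : ℂ → ℂ} {c : ℕ → ℂ} {R : ℝ} (hR : 0 < R)
    (hlarge : ∀ d : ℂ, R < ‖d‖ → HasSum (fun n => c n * d⁻¹ ^ n) (f d)) {L : ℕ}
    (hc : ∀ n < L, c n = 0) :
    Tendsto (fun d => f d * d ^ L) (Bornology.cobounded ℂ) (𝓝 (c L)) := by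
  have tail : ∀ d : ℂ, R < ‖d‖ → HasSum (fun n => c (n + L) * d⁻¹ ^ n) (f d * d ^ L) := by
    intro d hd
    have hd₀ : d ≠ 0 := norm_pos_iff.1 (hR.trans hd)
    have h := (hasSum_nat_add_iff' L).2 (hlarge d hd)
    rw [Finset.sum_eq_zero fun n hn => by rw [hc n (Finset.mem_range.1 hn), zero_mul],
      sub_zero] at h
    have h' := h.mul_right (d ^ L)
    refine h'.congr_fun ?_
    intro n
    rw [pow_add, inv_pow d L]
    field_simp
  let A : ℂ → ℂ := fun z => ∑' n, c (n + L) * z ^ n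
  have hA : HasFPowerSeriesAt A (FormalMultilinearSeries.ofScalars ℂ fun n => c (n + L)) 0 := by
    rw [hasFPowerSeriesAt_iff]
    filter_upwards [Metric.ball_mem_nhds (0 : ℂ) (inv_pos.2 hR)] with z hz
    rw [mem_ball_zero_iff] at hz
    simp only [FormalMultilinearSeries.coeff_ofScalars, smul_eq_mul, zero_add, mul_comm (z ^ _)]
    refine Summable.hasSum ?_
    by_cases hz₀ : z = 0
    · exact (hasSum_single (f := fun n => c (n + L) * z ^ n) 0 fun n hn => by
        simp [hz₀, hn]).summable
    · have := tail z⁻¹ (by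
        rw [norm_inv]
        exact (lt_inv_comm₀ (norm_pos_iff.2 hz₀) hR).1 hz)
      rw [inv_inv] at this
      exact this.summable
  have hA0 : A 0 = c L := by
    have := (hasSum_single (f := fun n => c (n + L) * (0 : ℂ) ^ n) 0 fun n hn => by
      simp [hn]).tsum_eq
    simpa using this
  have hlim := hA.continuousAt.tendsto.comp (Filter.tendsto_inv₀_cobounded (α := ℂ))
  rw [hA0] at hlim
  refine hlim.congr' ?_
  filter_upwards [tendsto_norm_cobounded_atTop.eventually_gt_atTop R] with d hd
  exact (tail d hd).tsum_eq

theorem differentiableAt_det {ι : Type*} [Fintype ι] [DecidableEq ι] {M : ℂ → Matrix ι ι ℂ}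
    {z : ℂ} (hM : ∀ i j, DifferentiableAt ℂ (fun d => M d i j) z) :
    DifferentiableAt ℂ (fun d => (M d).det) z := by
  simp only [Matrix.det_apply]
  fun_prop

/-- Cramer's rule: each entry is a quotient of polynomials in `d` whose denominator is the Gram
determinant. -/
theorem differentiableAt_Wg {k : ℕ} {z : ℂ} (h : IsUnit (gramMatrix k z)) (p q : NC2 k) :
    DifferentiableAt ℂ (fun d => Wg k d p q) z := by
  have hG : ∀ i j, DifferentiableAt ℂ (fun d => gramMatrix k d i j) z := by
    intro i j
    simp only [gramMatrix, Matrix.of_apply]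
    fun_prop
  have e : ∀ d, Wg k d p q = ((gramMatrix k d).det)⁻¹ * (gramMatrix k d).adjugate p q := by
    intro d
    rw [Wg, Matrix.inv_def, Ring.inverse_eq_inv', Matrix.smul_apply, smul_eq_mul]
  simp only [e, Matrix.adjugate_apply]
  rw [Matrix.isUnit_iff_isUnit_det, isUnit_iff_ne_zero] at h
  refine ((differentiableAt_det hG).inv h).mul (differentiableAt_det fun i j => ?_)
  by_cases hi : i = q
  · simp [Matrix.updateRow_apply, hi]
  · simpa [Matrix.updateRow_apply, hi] using hG i j

/-! ### The expansion in its final range and the leading term. -/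

namespace IsWeingartenSubgraph

variable {H : Digraph WgVertex} (hH : IsWeingartenSubgraph H) {k : ℕ} (p q : NC2 k)
include hH

theorem hasSum_signedWg {d : ℂ} (hd : 2 * Real.cos (Real.pi / (k + 1)) < ‖d‖) :
    HasSum (fun n => (dipathCount H ⟨k, p, q⟩ n : ℂ) * d⁻¹ ^ n) (signedWg d ⟨k, p, q⟩) := by
  cases k with
  -- For `k = 0` the bound is `2 cos π = -2`, so `d = 0` is allowed and continuation in `d⁻¹` is
  -- unavailable; the series is the constant `1`. For `k ≥ 1` the bound is nonnegative and forces `d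
  -- ≠ 0`.
  | zero =>
    rw [eq_emptyVertex, signedWg_empty]
    have := hasSum_single (f := fun n => (dipathCount H emptyVertex n : ℂ) * d⁻¹ ^ n) 0
      fun n hn => by rw [hH.dipathCount_empty, if_neg hn, Nat.cast_zero, zero_mul]
    simpa [hH.dipathCount_empty] using this
  | succ n =>
    obtain ⟨R, hR, h⟩ := hH.exists_hasSum_large ⟨n + 1, p, q⟩
    refine hasSum_of_hasSum_large (by linarith) h (fun z hz => ?_) hd ?_
    · exact (differentiableAt_Wg (isUnit_gramMatrix (chebS_ne_zero hz)) p q).const_mul _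
    · have hcos : 0 ≤ Real.cos (Real.pi / ((n + 1 : ℕ) + 1)) := by
        refine Real.cos_nonneg_of_neg_pi_div_two_le_of_le ?_ ?_
        · have : 0 ≤ Real.pi / ((n + 1 : ℕ) + 1) := by positivity
          linarith [Real.pi_pos]
        · refine div_le_div_of_nonneg_left Real.pi_pos.le two_pos ?_
          push_cast
          linarith [(Nat.cast_nonneg n : (0 : ℝ) ≤ n)]
      exact norm_pos_iff.1 (by linarith)

theorem dipathCount_eq_zero {v : WgVertex} {n : ℕ} (h : ∀ r, n ≠ wgDist v + 2 * r) :
    dipathCount H v n = 0 := by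
  rw [dipathCount, Set.ncard_eq_zero (finite_dipaths hH.finite_out _ _ _),
    ← Set.not_nonempty_iff_eq_empty]
  intro hne
  obtain ⟨r, hr⟩ := hH.exists_of_nonempty_dipaths hne
  exact h r hr

theorem hasSum_Wg {d : ℂ} (hd : 2 * Real.cos (Real.pi / (k + 1)) < ‖d‖) :
    HasSum (fun r : ℕ => (-1) ^ (p.joinCard q + k) * ((pathCount H ⟨k, p, q⟩ r : ℂ) *
        d ^ (-((wgDist ⟨k, p, q⟩ + 2 * r : ℕ) : ℤ)))) (Wg k d p q) := by
  rw [Wg_eq_signedWg]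
  refine HasSum.mul_left _ ?_
  have hinj : Function.Injective fun r : ℕ => wgDist ⟨k, p, q⟩ + 2 * r := fun a b h => by
    simp only at h
    omega
  -- By parity and minimality of the distance, only lengths `L + 2r` carry paths, so the series may
  -- be reindexed by `r`.
  have := (hinj.hasSum_iff fun n hn => ?_).2 (hH.hasSum_signedWg p q hd)
  · simpa only [Function.comp_def, zpow_neg, zpow_natCast, inv_pow, pathCount, dipathCount] using this
  · rw [hH.dipathCount_eq_zero, Nat.cast_zero, zero_mul]
    rintro r rfl
    exact hn ⟨r, rfl⟩

theorem one_le_pathCount_zero (v : WgVertex) : 1 ≤ pathCount H v 0 := by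
  rw [pathCount, Nat.one_le_iff_ne_zero, mul_zero, add_zero,
    Ne, Set.ncard_eq_zero (finite_dipaths hH.finite_out _ _ _)]
  exact (hH.nonempty_dipaths_wgDist v).ne_empty

theorem isEquivalent_Wg :
    Asymptotics.IsEquivalent (Bornology.cobounded ℂ) (fun d : ℂ => Wg k d p q)
      (fun d : ℂ => (pathCount H ⟨k, p, q⟩ 0 : ℂ) * (-1) ^ (k + p.joinCard q) *
        d ^ (-(wgDist ⟨k, p, q⟩ : ℤ))) := by
  obtain ⟨R, hR, h⟩ := hH.exists_hasSum_large ⟨k, p, q⟩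
  set L := wgDist ⟨k, p, q⟩ with hL
  have hm : (pathCount H ⟨k, p, q⟩ 0 : ℂ) ≠ 0 := by
    exact_mod_cast (Nat.one_le_iff_ne_zero.1 (hH.one_le_pathCount_zero ⟨k, p, q⟩))
  have hlim := tendsto_tail_of_hasSum_large (by linarith) h (L := L) fun n hn => by
    rw [hH.dipathCount_eq_zero, Nat.cast_zero]
    rintro r rfl
    omega
  rw [Asymptotics.isEquivalent_iff_exists_eq_mul]
  refine ⟨fun d => signedWg d ⟨k, p, q⟩ * d ^ L / pathCount H ⟨k, p, q⟩ 0, ?_, ?_⟩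
  · have := hlim.div_const (pathCount H ⟨k, p, q⟩ 0 : ℂ)
    have e : pathCount H ⟨k, p, q⟩ 0 = dipathCount H ⟨k, p, q⟩ L := rfl
    rwa [← e, div_self hm] at this
  · filter_upwards [tendsto_norm_cobounded_atTop.eventually_gt_atTop R] with d hd
    have hd₀ : d ≠ 0 := norm_pos_iff.1 (by linarith)
    rw [Pi.mul_apply, Wg_eq_signedWg, zpow_neg, zpow_natCast, add_comm k]
    field_simp

end IsWeingartenSubgraph

theorem theorem4 (H : Digraph WgVertex) (hH : IsWeingartenSubgraph H) (k : ℕ) (p q : NC2 k) :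
    -- coefficients of the dual basis, whenever the bilinear form is non-degenerate
    (∀ d : ℂ, (TL.form k d).Nondegenerate →
      IsUnit (gramMatrix k d) ∧
      (∃! E : Module.Basis (NC2 k) ℂ (TL k), TL.IsDualBasis k d E) ∧
      ∀ E : Module.Basis (NC2 k) ℂ (TL k), TL.IsDualBasis k d E →
        (TL.diagram k).repr (E p) q = Wg k d p q) ∧
    -- the Laurent expansion
    (∀ d : ℂ, 2 * Real.cos (Real.pi / (k + 1)) < ‖d‖ →
      (TL.form k d).Nondegenerate ∧
      Summable (fun r : ℕ => ‖(pathCount H ⟨k, p, q⟩ r : ℂ) *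
        d ^ (-((wgDist ⟨k, p, q⟩ + 2 * r : ℕ) : ℤ))‖) ∧
      HasSum (fun r : ℕ => (-1) ^ (p.joinCard q + k) * ((pathCount H ⟨k, p, q⟩ r : ℂ) *
        d ^ (-((wgDist ⟨k, p, q⟩ + 2 * r : ℕ) : ℤ)))) (Wg k d p q)) ∧
    -- the path counts are finite numbers, and the first one is not zero
    (∀ r, (dipaths H (wgDist ⟨k, p, q⟩ + 2 * r) ⟨k, p, q⟩ emptyVertex).Finite) ∧
    1 ≤ pathCount H ⟨k, p, q⟩ 0 ∧
    -- the leading term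
    Asymptotics.IsEquivalent (Bornology.cobounded ℂ) (fun d : ℂ => Wg k d p q)
      (fun d : ℂ => (pathCount H ⟨k, p, q⟩ 0 : ℂ) * (-1) ^ (k + p.joinCard q) *
        d ^ (-(wgDist ⟨k, p, q⟩ : ℤ))) := by
  refine ⟨fun d hd => ⟨(TL.nondegenerate_iff k d).1 hd, TL.existsUnique_dualBasis hd,
    fun E hE => TL.isDualBasis_coeff hE p q⟩, fun d hd => ?_,
    fun r => finite_dipaths hH.finite_out _ _ _, hH.one_le_pathCount_zero _,
    hH.isEquivalent_Wg p q⟩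
  have hsum := hH.hasSum_Wg p q hd
  refine ⟨(TL.nondegenerate_iff k d).2 (isUnit_gramMatrix (chebS_ne_zero hd)), ?_, hsum⟩
  have := hsum.summable.norm
  simpa only [norm_mul, norm_pow, norm_neg, norm_one, one_pow, one_mul] using this
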